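/- Let $A$ be a finite-dimensional algebra over a field $k$; modules are left modules. Let $(\Lambda,\le)$ be a finite poset, and let $\Theta=(\Theta_\lambda)_{\lambda\in\Lambda}$ be nonzero and $Q=(Q_\lambda)_{\lambda\in\Lambda}$ indecomposable finitely generated $A$-modules. Let $\mathcal F(\Theta)$ be the class of modules with a finite filtration all of whose factors are isomorphic to some $\Theta_\lambda$. Write also $\Theta=\bigoplus_\lambda\Theta_\lambda$ and $Q=\bigoplus_\lambda Q_\lambda$. The height $h:\Lambda\to\mathbb N$ is given by $h(\lambda)=1$ if $\lambda$ is minimal in $\Lambda$, $h(\lambda)=2$ if $\lambda$ becomes minimal after the minimal elements are removed, and so on. Assume that $(\Theta,Q)$ is an Ext-projective stratifying system, i.e. (1) $\operatorname{Hom}_A(\Theta_\lambda,\Theta_\mu)=0$ if $\lambda\nleq\mu$; (2) for each $\lambda$ there is an exact sequence $0\to K_\lambda\to Q_\lambda\to\Theta_\lambda\to0$ where $K_\lambda$ has a filtration with factors isomorphic to $\Theta_\mu$, $\mu>\lambda$; (3) $\operatorname{Ext}^1_A(Q_\lambda,M)=0$ for all $M\in\mathcal F(\Theta)$ and all $\lambda$.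 Assume moreover that every $\Theta_\lambda$ has a simple top, that the tops of $\Theta_\lambda$ and $\Theta_\mu$ are not isomorphic for $\lambda\ne\mu$, that $\operatorname{Ext}^s_A(Q,\Theta)=0$ for all $s\ge1$, and that $\operatorname{Hom}_A(Q,\Theta)\cong\operatorname{Hom}_A(\Theta,\Theta)$ as $\operatorname{End}_A(\Theta)$-modules. A module $M\in\mathcal F(\Theta)$ is generated in height $i$ if there is an exact sequence $0\to M[1]\to M\to\bigoplus_{h(\lambda)=i}\Theta_\lambda^{m_\lambda}\to0$, where $M[1]$ is filtered by modules $\Theta_\mu$ with $h(\mu)>i$, such that $M$ and $\bigoplus_{h(\lambda)=i}\Theta_\lambda^{m_\lambda}$ have isomorphic tops (so $0$ is generated in every height). A relative projective cover of $M\in\mathcal F(\Theta)$ is a right minimal surjection $P\to M$ with $P\in\operatorname{add}(Q)$ and kernel in $\mathcal F(\Theta)$; its kernel is the relative syzygy $\Omega_\Theta(M)$. The module $M$ is linearly filtered if there is an $i$ such that $\Omega^s_\Theta(M)$ is generated in height $i+s$ for all $s\ge0$. Assume finally that every $\Theta_\lambda$ is linearly filtered. Let $\Gamma=\operatorname{Ext}^*_A(\Theta,\Theta)$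 with the Yoneda product and its natural grading. A linear projective resolution of a graded $\Gamma$-module is a resolution $\cdots\to P^1\to P^0$ by graded projective modules and graded maps of degree $0$ such that $P^n$ is generated in degree $n$ for all $n\ge0$. Then for every linearly filtered $M\in\mathcal F(\Theta)$ the graded $\Gamma$-module $\operatorname{Ext}^*_A(M,\Theta)$ is generated in degree $0$ and has a linear projective resolution. In particular, $\Gamma$ is a generalized Koszul algebra: $\dim_k\Gamma_i<\infty$ and $\Gamma_i\Gamma_j=\Gamma_{i+j}$ for all $i,j\ge0$, and $\Gamma_0=\Gamma/\bigoplus_{i\ge1}\Gamma_i$ is generated in degree $0$ and has a linear projective resolution over $\Gamma$. -/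

import Mathlib

open CategoryTheory
open scoped DirectSum

universe u

noncomputable section

namespace ExtKoszul

/-! ### Graded algebras, graded modules, linear projective resolutions -/

section Graded

variable {k : Type*} [CommRing k] {R : Type*} [Ring R] [Algebra k R]

/-- `R = ⨁ R_i` is a graded `k`-algebra which is locally finite (every `R_i` is a finitely
generated `k`-module) and generated in degrees `0` and `1`, i.e. `R_i R_j = R_{i+j}`. -/
structure IsStandardGraded (𝒜 : ℕ → Submodule k R) : Prop where
  internal : DirectSum.IsInternal 𝒜
  one_mem : (1 : R) ∈ 𝒜 0
  locally_finite : ∀ i, Module.Finite k (𝒜 i)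
  mul_eq : ∀ i j, 𝒜 i * 𝒜 j = 𝒜 (i + j)

variable {M : Type*} [AddCommGroup M] [Module R M] {N : Type*} [AddCommGroup N] [Module R N]

/-- `M = ⨁ M_i` is a graded module over the graded algebra `R = ⨁ R_i`. -/
structure IsGradedModule (𝒜 : ℕ → Submodule k R) (ℳ : ℕ → AddSubgroup M) : Prop where
  internal : DirectSum.IsInternal ℳ
  smul_mem : ∀ (i j : ℕ) (a : R) (m : M), a ∈ 𝒜 i → m ∈ ℳ j → a • m ∈ ℳ (i + j)

variable (R) in
/-- `M` is generated in degree `s`: `M = R M_s`. -/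
def GeneratedInDegree (ℳ : ℕ → AddSubgroup M) (s : ℕ) : Prop :=
  Submodule.span R (ℳ s : Set M) = ⊤

/-- A homomorphism of graded modules (of degree `0`). -/
def IsGradedHom (ℳ : ℕ → AddSubgroup M) (𝒩 : ℕ → AddSubgroup N) (f : M →ₗ[R] N) : Prop :=
  ∀ (i : ℕ) (m : M), m ∈ ℳ i → f m ∈ 𝒩 i

/-- The graded module `M` has a linear projective resolution
`⋯ → P 2 → P 1 → P 0 → M → 0`: an exact complex of graded modules and graded homomorphisms, where
`P n` is projective and generated in degree `n`.

(A graded module is a projective object among graded modules iff it is a projective module.) -/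
def HasLinearResolution {R : Type u} [Ring R] [Algebra k R] {M : Type u} [AddCommGroup M]
    [Module R M] (𝒜 : ℕ → Submodule k R) (ℳ : ℕ → AddSubgroup M) : Prop :=
  ∃ (P : ℕ → ModuleCat.{u} R) (𝒬 : ∀ n, ℕ → AddSubgroup (P n))
    (d : ∀ n, P (n + 1) →ₗ[R] P n) (ε : P 0 →ₗ[R] M),
    (∀ n, IsGradedModule 𝒜 (𝒬 n)) ∧
    (∀ n, Module.Projective R (P n)) ∧
    (∀ n, GeneratedInDegree R (𝒬 n) n) ∧
    (∀ n, IsGradedHom (𝒬 (n + 1)) (𝒬 n) (d n)) ∧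
    IsGradedHom (𝒬 0) ℳ ε ∧
    (∀ n, Function.Exact (d (n + 1)) (d n)) ∧
    Function.Exact (d 0) ε ∧
    Function.Surjective ε

/-- A (generalized) Koszul module, also called a linear module: a graded module generated in
degree `0` that has a linear projective resolution. -/
structure IsKoszulModule {R : Type u} [Ring R] [Algebra k R] {M : Type u} [AddCommGroup M]
    [Module R M] (𝒜 : ℕ → Submodule k R) (ℳ : ℕ → AddSubgroup M) : Prop where
  graded : IsGradedModule 𝒜 ℳ
  generated : GeneratedInDegree R ℳ 0
  linear : HasLinearResolution 𝒜 ℳ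

/-- The ideal `J = ⨁_{i ≥ 1} R_i`, as a left ideal. -/
def posIdeal (𝒜 : ℕ → Submodule k R) : Submodule R R :=
  Submodule.span R (⋃ i : ℕ, (𝒜 (i + 1) : Set R))

/-- The grading of `R_0 = R / J` as an `R`-module: it is concentrated in degree `0`. -/
def degZeroGrading (𝒜 : ℕ → Submodule k R) (i : ℕ) : AddSubgroup (R ⧸ posIdeal 𝒜) :=
  if i = 0 then ⊤ else ⊥

/-- `R` is a generalized Koszul algebra: a locally finite graded algebra generated in degrees `0`
and `1` such that `R_0 = R / J`, viewed as a graded `R`-module, is Koszul. -/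
structure IsKoszulAlgebra {R : Type u} [Ring R] [Algebra k R] (𝒜 : ℕ → Submodule k R) :
    Prop where
  graded : IsStandardGraded 𝒜
  koszul : IsKoszulModule 𝒜 (degZeroGrading 𝒜)

end Graded

/-! ### Heights in a poset -/

section Height

variable {Λ : Type*} [PartialOrder Λ]

/-- What remains of the poset after the successive removal of `n` layers of minimal elements. -/
def remaining : ℕ → Set Λ
  | 0 => Set.univ
  | n + 1 => {x | x ∈ remaining n ∧ ¬ Minimal (· ∈ remaining n) x}

/-- The height of `x` is `i` if `x` belongs to the `i`-th layer (`i ≥ 1`), i.e. if it is removed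
in the `i`-th step: the minimal elements have height `1`, and so on. -/
def ht (x : Λ) : ℕ := sInf {n | x ∉ remaining n}

end Height

/-! ### Filtrations, tops, indecomposable modules -/

section Modules

variable {A : Type u} [Ring A]

/-- The top `M / rad M` of a module. -/
abbrev TopOf (A : Type u) [Ring A] (M : Type u) [AddCommGroup M] [Module A M] : Type u :=
  M ⧸ Module.jacobson A M

/-- Indecomposable modules (the zero module is not indecomposable). -/
def IsIndecomposable (A : Type u) [Ring A] (M : Type u) [AddCommGroup M] [Module A M] : Prop :=
  Nontrivial M ∧ ∀ p q : Submodule A M, IsCompl p q → p = ⊥ ∨ q = ⊥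

variable {Λ : Type u}

/-- `M` has a finite filtration `0 = F 0 ≤ F 1 ≤ ⋯ ≤ F n = M` every factor of which is isomorphic
to some `Θ μ` with `μ ∈ S`. -/
def HasFiltration (Θ : Λ → ModuleCat.{u} A) (S : Set Λ)
    (M : Type u) [AddCommGroup M] [Module A M] : Prop :=
  ∃ (n : ℕ) (F : ℕ → Submodule A M), F 0 = ⊥ ∧ F n = ⊤ ∧ Monotone F ∧
    ∀ i < n, ∃ μ ∈ S,
      Nonempty ((F (i + 1) ⧸ (F i).submoduleOf (F (i + 1))) ≃ₗ[A] Θ μ)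

/-- The category `𝓕(Θ)`. -/
abbrev InF (Θ : Λ → ModuleCat.{u} A) (M : Type u) [AddCommGroup M] [Module A M] : Prop :=
  HasFiltration Θ Set.univ M

/-- The direct sum of a finite family of modules. -/
abbrev total [Finite Λ] (Θ : Λ → ModuleCat.{u} A) : ModuleCat.{u} A :=
  ModuleCat.of A (∀ i, Θ i)

/-- `(Θ, Q)` is an Ext-projective stratifying system of finitely generated `A`-modules, indexed by
the poset `Λ`. -/
structure IsEPSS [PartialOrder Λ] (Θ Q : Λ → ModuleCat.{u} A) : Prop where
  finite_Θ : ∀ i, Module.Finite A (Θ i)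
  finite_Q : ∀ i, Module.Finite A (Q i)
  nonzero : ∀ i, Nontrivial (Θ i)
  indecomposable : ∀ i, IsIndecomposable A (Q i)
  hom_eq_zero : ∀ i j, ¬ i ≤ j → ∀ f : Θ i →ₗ[A] Θ j, f = 0
  exact : ∀ i, ∃ f : Q i →ₗ[A] Θ i, Function.Surjective f ∧
    HasFiltration Θ {j | i < j} (LinearMap.ker f)
  ext_eq_zero : ∀ (i : Λ) (M : ModuleCat.{u} A), InF Θ M → Subsingleton (Abelian.Ext (Q i) M 1)

/-- `P` is in `add Q`: it is isomorphic to a direct summand of a finite direct sum of copies of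
`Q = ⨁ Q_i`. -/
def InAdd [Finite Λ] (Q : Λ → ModuleCat.{u} A) (P : Type u) [AddCommGroup P] [Module A P] :
    Prop :=
  ∃ (n : ℕ) (s : P →ₗ[A] (Fin n → total Q)) (r : (Fin n → total Q) →ₗ[A] P),
    r ∘ₗ s = LinearMap.id

/-- `f : P → M` is a relative projective cover of `M` in `𝓕(Θ)`: `P` is in `add Q`, `f` is
surjective with kernel in `𝓕(Θ)`, and `f` is right minimal. -/
structure IsRelCover [Finite Λ] (Θ Q : Λ → ModuleCat.{u} A) {P M : Type u}
    [AddCommGroup P] [Module A P] [AddCommGroup M] [Module A M] (f : P →ₗ[A] M) : Prop where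
  inAdd : InAdd Q P
  surjective : Function.Surjective f
  ker_inF : InF Θ (LinearMap.ker f)
  minimal : ∀ g : P →ₗ[A] P, f ∘ₗ g = f → Function.Bijective g

/-- `L` is (isomorphic to) the relative syzygy `Ω_Θ(M)`, the kernel of a relative projective
cover of `M`. -/
def IsRelSyzygy [Finite Λ] (Θ Q : Λ → ModuleCat.{u} A) (M L : ModuleCat.{u} A) : Prop :=
  ∃ (P : ModuleCat.{u} A) (f : P →ₗ[A] M), IsRelCover Θ Q f ∧
    Nonempty (L ≃ₗ[A] LinearMap.ker f)

/-- The module `⨁_{h(j) = i} Θ_j^{m_j}`. -/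
abbrev layerSum [PartialOrder Λ] (Θ : Λ → ModuleCat.{u} A) (i : ℕ) (m : Λ → ℕ) : Type u :=
  ∀ j : {j : Λ // ht j = i}, Fin (m j) → Θ j

/-- `M` in `𝓕(Θ)` is generated in height `i`: there is an exact sequence
`0 → M[1] → M → ⨁_{h(j) = i} Θ_j^{m_j} → 0` where `M[1]` is filtered by the `Θ_j` with `h(j) > i`,
and `M` and `⨁_{h(j) = i} Θ_j^{m_j}` have isomorphic tops. The zero module is generated in every
height; for `M ≠ 0` the conditions force some `m_j` to be nonzero, so `i` is the minimal height of
the factors of `M`, and `m_j` is the multiplicity of `Θ_j` in `M`. -/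
def GeneratedInHeight [PartialOrder Λ] (Θ : Λ → ModuleCat.{u} A) (i : ℕ)
    (M : Type u) [AddCommGroup M] [Module A M] : Prop :=
  InF Θ M ∧ ∃ (m : Λ → ℕ) (p : M →ₗ[A] layerSum Θ i m),
    Function.Surjective p ∧ HasFiltration Θ {j | i < ht j} (LinearMap.ker p) ∧
    Nonempty (TopOf A M ≃ₗ[A] TopOf A (layerSum Θ i m))

/-- `M` in `𝓕(Θ)` is linearly filtered: for some `i`, the `s`-th relative syzygy `Ω_Θ^s(M)` is
generated in height `i + s` for all `s ≥ 0`. -/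
def IsLinearlyFiltered [PartialOrder Λ] [Finite Λ] (Θ Q : Λ → ModuleCat.{u} A)
    (M : ModuleCat.{u} A) : Prop :=
  ∃ (i : ℕ) (Ω : ℕ → ModuleCat.{u} A), Nonempty (Ω 0 ≃ₗ[A] M) ∧
    (∀ s, IsRelSyzygy Θ Q (Ω s) (Ω (s + 1))) ∧
    ∀ s, GeneratedInHeight Θ (i + s) (Ω s)

/-- `Hom_A(X, T) ≅ Hom_A(T, T)` as left modules over `End_A(T)`, which acts by
post-composition. -/
def HomIsoEnd (X T : ModuleCat.{u} A) : Prop :=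
  ∃ e : (X →ₗ[A] T) ≃+ (T →ₗ[A] T),
    ∀ (g : T →ₗ[A] T) (f : X →ₗ[A] T), e (g ∘ₗ f) = g ∘ₗ e f

end Modules

/-! ### The extension algebra and its graded modules -/

section ExtAlgebra

variable {A : Type u} [Ring A]

/-- The groups `Ext^n_A(X, Y)`. -/
abbrev ExtFam (X Y : ModuleCat.{u} A) (n : ℕ) : Type u := Abelian.Ext X Y n

/-- Equality of homogeneous elements of a priori different degrees. -/
theorem mk_eq_mk {X Y : ModuleCat.{u} A} {m n : ℕ} (h : m = n) (a : ExtFam X Y m)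
    (b : ExtFam X Y n)
    (hab : ∀ h' : m + 0 = n, Abelian.Ext.comp a (Abelian.Ext.mk₀ (𝟙 Y)) h' = b) :
    GradedMonoid.mk (A := ExtFam X Y) m a = GradedMonoid.mk n b := by
  subst h
  rw [← hab (add_zero m), Abelian.Ext.comp_mk₀_id]

instance instGOneExt (T : ModuleCat.{u} A) : GradedMonoid.GOne (ExtFam T T) where
  one := Abelian.Ext.mk₀ (𝟙 T)

/-- The Yoneda product: `x * y` is "`x` after `y`". -/
instance instGMulExt (T : ModuleCat.{u} A) : GradedMonoid.GMul (ExtFam T T) where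
  mul {i j} x y := Abelian.Ext.comp y x (add_comm j i)

/-- `Γ = Ext^*_A(T, T)` acts on the left of `Ext^*_A(M, T)` by the Yoneda product. -/
instance instGSMulExt (M T : ModuleCat.{u} A) :
    GradedMonoid.GSMul (ExtFam T T) (ExtFam M T) where
  smul {i j} x y := Abelian.Ext.comp y x (add_comm j i)

/-- The axioms of a graded action, from which those of the graded ring are a special case. -/
theorem ext_one_smul {M T : ModuleCat.{u} A} {n : ℕ} (a : ExtFam M T n) :
    GradedMonoid.mk (A := ExtFam M T) (0 + n)
      (Abelian.Ext.comp a (Abelian.Ext.mk₀ (𝟙 T)) (add_comm n 0)) = GradedMonoid.mk n a := by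
  refine mk_eq_mk (zero_add n) _ _ fun h' => ?_
  rw [Abelian.Ext.comp_assoc _ _ _ (add_comm n 0) (add_zero 0) (by omega)]
  simp

theorem ext_mul_smul {M S U V : ModuleCat.{u} A} {l m n : ℕ} (a : ExtFam U V l)
    (b : ExtFam S U m) (c : ExtFam M S n) :
    GradedMonoid.mk (A := ExtFam M V) (l + m + n)
      (Abelian.Ext.comp c (Abelian.Ext.comp b a (add_comm m l)) (add_comm n (l + m))) =
    GradedMonoid.mk (l + (m + n))
      (Abelian.Ext.comp (Abelian.Ext.comp c b (add_comm n m)) a (add_comm (m + n) l)) := by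
  refine mk_eq_mk (add_assoc l m n) _ _ fun h' => ?_
  rw [Abelian.Ext.comp_assoc c b a (add_comm n m) (add_comm m l) (by omega),
    Abelian.Ext.comp_assoc c _ _ (add_comm n (l + m)) (add_zero (l + m)) (by omega)]
  simp

/-- The extension algebra `Γ = Ext^*_A(T, T)`. -/
instance instGRingExt (T : ModuleCat.{u} A) : DirectSum.GRing (ExtFam T T) where
  mul_zero a := Abelian.Ext.zero_comp _ _ _ _ _
  zero_mul b := Abelian.Ext.comp_zero _ _ _ _ _
  mul_add a b c := Abelian.Ext.add_comp _ _ _ _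
  add_mul a b c := Abelian.Ext.comp_add _ _ _ _
  one_mul := by
    rintro ⟨n, a⟩
    exact ext_one_smul a
  mul_one := by
    rintro ⟨n, a⟩
    refine mk_eq_mk (add_zero n) _ _ fun h' => ?_
    change Abelian.Ext.comp (Abelian.Ext.comp (Abelian.Ext.mk₀ (𝟙 T)) a _) _ _ = a
    simp
  mul_assoc := by
    rintro ⟨l, a⟩ ⟨m, b⟩ ⟨n, c⟩
    exact ext_mul_smul a b c
  natCast n := n • Abelian.Ext.mk₀ (𝟙 T)
  natCast_zero := zero_smul _ _
  natCast_succ n := succ_nsmul _ _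
  intCast n := n • Abelian.Ext.mk₀ (𝟙 T)
  intCast_ofNat n := natCast_zsmul _ _
  intCast_negSucc_ofNat n := negSucc_zsmul _ _

instance instGmoduleExt (M T : ModuleCat.{u} A) :
    DirectSum.Gmodule (ExtFam T T) (ExtFam M T) where
  smul_zero a := Abelian.Ext.zero_comp _ _ _ _ _
  zero_smul b := Abelian.Ext.comp_zero _ _ _ _ _
  smul_add a b c := Abelian.Ext.add_comp _ _ _ _
  add_smul a b c := Abelian.Ext.comp_add _ _ _ _
  one_smul := by
    rintro ⟨n, a⟩
    exact ext_one_smul a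
  mul_smul := by
    rintro ⟨l, a⟩ ⟨m, b⟩ ⟨n, c⟩
    exact ext_mul_smul a b c

variable {k : Type u} [Field k] [Algebra k A]

instance instGAlgebraExt (T : ModuleCat.{u} A) : DirectSum.GAlgebra k (ExtFam T T) where
  toFun :=
    { toFun := fun r => r • Abelian.Ext.mk₀ (𝟙 T)
      map_zero' := by simp
      map_add' := fun r s => add_smul _ _ _ }
  map_one := one_smul _ _
  map_mul r s := by
    refine mk_eq_mk rfl _ _ fun h' => ?_
    change _ = Abelian.Ext.comp (s • Abelian.Ext.mk₀ (𝟙 T)) (r • Abelian.Ext.mk₀ (𝟙 T)) _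
    simp [mul_smul]
  commutes := by
    rintro r ⟨n, a⟩
    refine mk_eq_mk (add_comm 0 n) _ _ fun h' => ?_
    change Abelian.Ext.comp (Abelian.Ext.comp a (r • Abelian.Ext.mk₀ (𝟙 T)) _) _ _ =
      Abelian.Ext.comp (r • Abelian.Ext.mk₀ (𝟙 T)) a _
    rw [Abelian.Ext.comp_assoc _ _ _ (add_comm n 0) (add_zero 0) (by omega),
      Abelian.Ext.comp_mk₀_id]
    exact (Abelian.Ext.comp_smul _ _ _ _).trans
      ((congrArg (r • ·) ((Abelian.Ext.comp_mk₀_id a).trans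
        (Abelian.Ext.mk₀_id_comp a).symm)).trans (Abelian.Ext.smul_comp _ _ _ _).symm)
  smul_def := by
    rintro r ⟨n, a⟩
    refine mk_eq_mk (zero_add n).symm _ _ fun h' => ?_
    change Abelian.Ext.comp (r • a) _ _ = Abelian.Ext.comp a (r • Abelian.Ext.mk₀ (𝟙 T)) _
    exact (Abelian.Ext.smul_comp _ _ _ _).trans (Abelian.Ext.comp_smul _ _ _ _).symm

/-- The extension algebra `Γ = Ext^*_A(T, T) = ⨁ Ext^n_A(T, T)`. -/
def ExtAlg (T : ModuleCat.{u} A) : Type u := ⨁ n, ExtFam T T n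

/-- The graded `Γ`-module `Ext^*_A(M, T) = ⨁ Ext^n_A(M, T)`. -/
def ExtMod (M T : ModuleCat.{u} A) : Type u := ⨁ n, ExtFam M T n

instance (T : ModuleCat.{u} A) : Ring (ExtAlg T) :=
  inferInstanceAs (Ring (⨁ n, ExtFam T T n))

instance (T : ModuleCat.{u} A) : Algebra k (ExtAlg T) :=
  inferInstanceAs (Algebra k (⨁ n, ExtFam T T n))

instance (M T : ModuleCat.{u} A) : AddCommGroup (ExtMod M T) :=
  inferInstanceAs (AddCommGroup (⨁ n, ExtFam M T n))

instance (M T : ModuleCat.{u} A) : Module (ExtAlg T) (ExtMod M T) :=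
  inferInstanceAs (Module (⨁ n, ExtFam T T n) (⨁ n, ExtFam M T n))

variable (k) in
/-- The inclusion of `Ext^n_A(T, T)` into `Γ`. -/
def algOf (T : ModuleCat.{u} A) (n : ℕ) : ExtFam T T n →ₗ[k] ExtAlg T :=
  DirectSum.lof k ℕ (ExtFam T T) n

/-- The inclusion of `Ext^n_A(M, T)` into `Ext^*_A(M, T)`. -/
def modOf (M T : ModuleCat.{u} A) (n : ℕ) : ExtFam M T n →+ ExtMod M T :=
  DirectSum.of (ExtFam M T) n

theorem algOf_mul_algOf (T : ModuleCat.{u} A) {i j : ℕ} (x : ExtFam T T i) (y : ExtFam T T j) :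
    algOf k T i x * algOf k T j y =
      algOf k T (i + j) (Abelian.Ext.comp y x (add_comm j i)) :=
  DirectSum.of_mul_of (A := ExtFam T T) x y

theorem algOf_smul_modOf (M T : ModuleCat.{u} A) {i j : ℕ} (x : ExtFam T T i)
    (y : ExtFam M T j) :
    algOf k T i x • modOf M T j y =
      modOf M T (i + j) (Abelian.Ext.comp y x (add_comm j i)) :=
  DirectSum.Gmodule.of_smul_of (ExtFam T T) (ExtFam M T) x y

variable (k) in
/-- The grading of the extension algebra `Γ = Ext^*_A(T, T)`. -/
def extAlgGrading (T : ModuleCat.{u} A) (n : ℕ) : Submodule k (ExtAlg T) :=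
  LinearMap.range (algOf k T n)

/-- The grading of `Ext^*_A(M, T)`. -/
def extModGrading (M T : ModuleCat.{u} A) (n : ℕ) : AddSubgroup (ExtMod M T) :=
  (modOf M T n).range

end ExtAlgebra

end ExtKoszul

end

/-! Write `Θ` also for the total direct sum and `Γ` for its Ext-algebra. Suppose `N ⊆ M` has `M/N`
in add `Θ` and the restriction Ext^*(M,Θ) → Ext^*(N,Θ) is zero. The long exact sequence then breaks
into short exact sequences 0 → Ext^{*-1}(N,Θ) → Ext^*(M/N,Θ) → Ext^*(M,Θ) → 0, whose middle term is
a projective `Γ`-module generated in degree 0. If `N` again has such a submodule, and so on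
(`Good`), splicing gives a linear resolution, since every connecting map raises the degree by one
(`hasLinearResolution_of_filtrations`).

It remains to see that linearly filtered modules are good (`IsLinearSeq.good`), by induction on the
number of heights left. Let `M` be generated in height `i`, let `N = M[1]` and `T = M/N`, and let `P
→ T` be a sum of relative covers of the `Θ_μ`, with kernel `K`. It lifts to `P → M`, which is onto
because `M` and `T` have the same top. Its kernel `X` gives 0 → X → K → N → 0. By uniqueness of
minimal covers `X` is the syzygy of `M` (`IsRelProj.exists_equiv`), and `K` is a sum of syzygies of
the `Θ_μ`, so both are good one height up. Goodness passes to the cokernel `N` (`good_coker`). The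
map Ext^*(N,Θ) → Ext^*(K,Θ) is injective because Ext^*(K,Θ) → Ext^*(X,Θ) is onto
(`pull_surjective`). The composite Ext^*(M,Θ) → Ext^*(N,Θ) → Ext^*(K,Θ) factors through Ext^*(P,Θ) →
Ext^*(K,Θ), which is zero: in positive degrees because Ext^s(Q,Θ) = 0, in degree 0 because the Hom
condition makes every map `P → Θ_μ` factor through `T` (`HomIsoEnd.factor`, `IsEPSS.exists_cover`).
Hence Ext^*(M,Θ) → Ext^*(N,Θ) is zero. The simple, pairwise different tops enter through closure of
𝓕(Θ) under kernels of surjections (`filt_ker`).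

For `Γ` itself, take the sum `P → Θ` of all covers, with kernel `K`. Then Ext^*(P,Θ) is `Γ_0`, and
`P` is good with first step `K`, so `Γ_0` has a linear resolution. Dimension shifting along `P`
shows that `Γ_{n+1} = Γ_n Γ_1`. -/

noncomputable section

namespace ExtKoszul

/-! ### Functoriality and long exact sequences of Ext for modules. -/

section ExtTools

variable {A : Type u} [Ring A]

/-- Precomposition with a linear map on `Ext`. -/
def pull {X Y : ModuleCat.{u} A} (f : X →ₗ[A] Y) (W : ModuleCat.{u} A) (n : ℕ) :
    Abelian.Ext Y W n →+ Abelian.Ext X W n :=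
  (Abelian.Ext.mk₀ (ModuleCat.ofHom f)).precomp W (zero_add n)

/-- Postcomposition with a linear map on `Ext`. -/
def push {X Y : ModuleCat.{u} A} (f : X →ₗ[A] Y) (W : ModuleCat.{u} A) (n : ℕ) :
    Abelian.Ext W X n →+ Abelian.Ext W Y n :=
  (Abelian.Ext.mk₀ (ModuleCat.ofHom f)).postcomp W (add_zero n)

theorem pull_apply {X Y : ModuleCat.{u} A} (f : X →ₗ[A] Y) {W : ModuleCat.{u} A} {n : ℕ}
    (y : Abelian.Ext Y W n) :
    pull f W n y = (Abelian.Ext.mk₀ (ModuleCat.ofHom f)).comp y (zero_add n) := rfl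

theorem push_apply {X Y : ModuleCat.{u} A} (f : X →ₗ[A] Y) {W : ModuleCat.{u} A} {n : ℕ}
    (y : Abelian.Ext W X n) :
    push f W n y = y.comp (Abelian.Ext.mk₀ (ModuleCat.ofHom f)) (add_zero n) := rfl

theorem pull_id {X W : ModuleCat.{u} A} {n : ℕ} (x : Abelian.Ext X W n) :
    pull LinearMap.id W n x = x :=
  Abelian.Ext.mk₀_id_comp x

theorem push_id {X W : ModuleCat.{u} A} {n : ℕ} (x : Abelian.Ext W X n) :
    push LinearMap.id W n x = x :=
  Abelian.Ext.comp_mk₀_id x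

theorem pull_pull {X Y Z W : ModuleCat.{u} A} (f : X →ₗ[A] Y) (g : Y →ₗ[A] Z) {n : ℕ}
    (z : Abelian.Ext Z W n) : pull f W n (pull g W n z) = pull (g ∘ₗ f) W n z :=
  Abelian.Ext.mk₀_comp_mk₀_assoc _ _ z

theorem push_push {X Y Z W : ModuleCat.{u} A} (f : X →ₗ[A] Y) (g : Y →ₗ[A] Z) {n : ℕ}
    (x : Abelian.Ext W X n) : push g W n (push f W n x) = push (g ∘ₗ f) W n x := by
  simp [push_apply, ModuleCat.ofHom_comp]

theorem pull_zero {X Y W : ModuleCat.{u} A} {n : ℕ} (y : Abelian.Ext Y W n) :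
    pull (0 : X →ₗ[A] Y) W n y = 0 := by
  rw [pull_apply]
  exact (congrArg (fun t => Abelian.Ext.comp t y (zero_add n))
    (Abelian.Ext.mk₀_zero X Y)).trans (Abelian.Ext.zero_comp _ _ _ _ _)

theorem pull_sum {ι : Type*} [Fintype ι] {X Y W : ModuleCat.{u} A} (f : ι → X →ₗ[A] Y) {n : ℕ}
    (y : Abelian.Ext Y W n) : pull (∑ i, f i) W n y = ∑ i, pull (f i) W n y := by
  simp only [pull_apply]
  rw [← Abelian.Ext.sum_comp, ← Abelian.Ext.mk₀_sum]
  congr 2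
  ext x
  simp

theorem push_sum {ι : Type*} [Fintype ι] {X Y W : ModuleCat.{u} A} (f : ι → X →ₗ[A] Y) {n : ℕ}
    (x : Abelian.Ext W X n) : push (∑ i, f i) W n x = ∑ i, push (f i) W n x := by
  simp only [push_apply]
  rw [← Abelian.Ext.comp_sum, ← Abelian.Ext.mk₀_sum]
  congr 2
  ext x
  simp

/-- Short exact sequences of modules. -/
structure SES {X Y Z : ModuleCat.{u} A} (f : X →ₗ[A] Y) (g : Y →ₗ[A] Z) : Prop where
  inj : Function.Injective f
  exact : Function.Exact f g
  surj : Function.Surjective g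

namespace SES

variable {X Y Z : ModuleCat.{u} A} {f : X →ₗ[A] Y} {g : Y →ₗ[A] Z}

theorem comp_eq_zero (h : SES f g) : g ∘ₗ f = 0 :=
  LinearMap.ext fun x => h.exact.apply_apply_eq_zero x

/-- The associated short complex. -/
abbrev complex (h : SES f g) : ShortComplex (ModuleCat.{u} A) :=
  ShortComplex.mk (ModuleCat.ofHom f) (ModuleCat.ofHom g) (by
    rw [← ModuleCat.ofHom_comp, h.comp_eq_zero]; rfl)

theorem shortExact (h : SES f g) : h.complex.ShortExact where
  exact := (ShortComplex.ShortExact.moduleCat_exact_iff_function_exact _).2 h.exact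
  mono_f := (ModuleCat.mono_iff_injective _).2 h.inj
  epi_g := (ModuleCat.epi_iff_surjective _).2 h.surj

/-- The class of a short exact sequence. -/
def cls (h : SES f g) : Abelian.Ext Z X 1 := h.shortExact.extClass

variable {W : ModuleCat.{u} A}

theorem exists_pull_of_pull_eq_zero (h : SES f g) {n : ℕ} {y : Abelian.Ext Y W n}
    (hy : pull f W n y = 0) : ∃ z, pull g W n z = y :=
  Abelian.Ext.contravariant_sequence_exact₂ h.shortExact W y hy

theorem exists_push_of_push_eq_zero (h : SES f g) {n : ℕ} {y : Abelian.Ext W Y n}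
    (hy : push g W n y = 0) : ∃ z, push f W n z = y :=
  Abelian.Ext.covariant_sequence_exact₂ W h.shortExact y hy

theorem exists_cls_comp (h : SES f g) {n : ℕ} {z : Abelian.Ext Z W (n + 1)}
    (hz : pull g W (n + 1) z = 0) :
    ∃ x : Abelian.Ext X W n, h.cls.comp x (add_comm 1 n) = z :=
  Abelian.Ext.contravariant_sequence_exact₃ h.shortExact W z hz (add_comm 1 n)

theorem exists_pull_of_cls_comp (h : SES f g) {n : ℕ} {x : Abelian.Ext X W n}
    (hx : h.cls.comp x (add_comm 1 n) = 0) : ∃ y, pull f W n y = x :=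
  Abelian.Ext.contravariant_sequence_exact₁ h.shortExact W x (add_comm 1 n) hx

theorem exists_push_of_comp_cls (h : SES f g) {n : ℕ} {z : Abelian.Ext W Z n}
    (hz : z.comp h.cls (rfl : n + 1 = n + 1) = 0) : ∃ y, push g W n y = z :=
  Abelian.Ext.covariant_sequence_exact₃ W h.shortExact z rfl hz

theorem cls_comp_pull (h : SES f g) {n : ℕ} (y : Abelian.Ext Y W n) :
    h.cls.comp (pull f W n y) (add_comm 1 n) = 0 :=
  h.shortExact.extClass_comp_assoc y

theorem pull_cls_comp (h : SES f g) {n : ℕ} (x : Abelian.Ext X W n) :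
    pull g W (n + 1) (h.cls.comp x (add_comm 1 n)) = 0 :=
  h.shortExact.comp_extClass_assoc x (add_comm 1 n)

end SES

theorem pull_zero_injective {Y Z : ModuleCat.{u} A} {g : Y →ₗ[A] Z} (hg : Function.Surjective g)
    (W : ModuleCat.{u} A) : Function.Injective (pull g W 0) :=
  haveI : Epi (ModuleCat.ofHom g) := (ModuleCat.epi_iff_surjective _).2 hg
  Abelian.Ext.precomp_mk₀_injective_of_epi W (ModuleCat.ofHom g)

/-- Elements of `Ext⁰` are linear maps. -/
theorem exists_mk₀ {X Y : ModuleCat.{u} A} (x : Abelian.Ext X Y 0) :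
    ∃ f : X →ₗ[A] Y, x = Abelian.Ext.mk₀ (ModuleCat.ofHom f) :=
  ⟨(Abelian.Ext.addEquiv₀ x).hom, (Abelian.Ext.mk₀_addEquiv₀_apply x).symm⟩

theorem mk₀_ofHom_injective {X Y : ModuleCat.{u} A} {f g : X →ₗ[A] Y}
    (h : Abelian.Ext.mk₀ (ModuleCat.ofHom f) = Abelian.Ext.mk₀ (ModuleCat.ofHom g)) : f = g :=
  congrArg ModuleCat.Hom.hom ((Abelian.Ext.mk₀_bijective X Y).1 h)

theorem mk₀_ofHom_zero (X Y : ModuleCat.{u} A) :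
    Abelian.Ext.mk₀ (ModuleCat.ofHom (0 : X →ₗ[A] Y)) = 0 :=
  Abelian.Ext.mk₀_zero X Y

theorem pull_mk₀ {X Y Z : ModuleCat.{u} A} (f : X →ₗ[A] Y) (g : Y →ₗ[A] Z) :
    pull f Z 0 (Abelian.Ext.mk₀ (ModuleCat.ofHom g)) =
      Abelian.Ext.mk₀ (ModuleCat.ofHom (g ∘ₗ f)) :=
  Abelian.Ext.mk₀_comp_mk₀ _ _

theorem push_mk₀ {X Y Z : ModuleCat.{u} A} (f : X →ₗ[A] Y) (g : Y →ₗ[A] Z) :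
    push g X 0 (Abelian.Ext.mk₀ (ModuleCat.ofHom f)) =
      Abelian.Ext.mk₀ (ModuleCat.ofHom (g ∘ₗ f)) :=
  Abelian.Ext.mk₀_comp_mk₀ _ _

namespace SES

variable {X Y Z : ModuleCat.{u} A} {f : X →ₗ[A] Y} {g : Y →ₗ[A] Z} {W : ModuleCat.{u} A}

theorem pull_injective_succ (h : SES f g) {n : ℕ} (hf : Function.Surjective (pull f W n)) :
    Function.Injective (pull g W (n + 1)) := by
  refine (injective_iff_map_eq_zero _).2 fun z hz => ?_
  obtain ⟨x, rfl⟩ := h.exists_cls_comp hz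
  obtain ⟨y, rfl⟩ := hf x
  exact h.cls_comp_pull y

/-- If every class on `X` extends to `Y`, the connecting map vanishes. Degree 0 is left exactness of
Hom. -/
theorem pull_injective (h : SES f g) (hf : ∀ n, Function.Surjective (pull f W n)) :
    ∀ n, Function.Injective (pull g W n)
  | 0 => pull_zero_injective h.surj W
  | n + 1 => h.pull_injective_succ (hf n)

theorem extend (h : SES f g) (hZ : Subsingleton (Abelian.Ext Z W 1)) (φ : X →ₗ[A] W) :
    ∃ ψ : Y →ₗ[A] W, ψ ∘ₗ f = φ := by
  obtain ⟨y, hy⟩ := h.exists_pull_of_cls_comp (W := W) (n := 0)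
    (x := Abelian.Ext.mk₀ (ModuleCat.ofHom φ)) (hZ.elim _ _)
  obtain ⟨ψ, rfl⟩ := exists_mk₀ y
  rw [pull_mk₀] at hy
  exact ⟨ψ, mk₀_ofHom_injective hy⟩

theorem lift (h : SES f g) (hW : Subsingleton (Abelian.Ext W X 1)) (φ : W →ₗ[A] Z) :
    ∃ ψ : W →ₗ[A] Y, g ∘ₗ ψ = φ := by
  obtain ⟨y, hy⟩ := h.exists_push_of_comp_cls (W := W) (n := 0)
    (z := Abelian.Ext.mk₀ (ModuleCat.ofHom φ)) (hW.elim _ _)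
  obtain ⟨ψ, rfl⟩ := exists_mk₀ y
  rw [push_mk₀] at hy
  exact ⟨ψ, mk₀_ofHom_injective hy⟩

theorem subsingleton_left (h : SES f g) {n : ℕ} (hX : Subsingleton (Abelian.Ext X W n))
    (hZ : Subsingleton (Abelian.Ext Z W n)) : Subsingleton (Abelian.Ext Y W n) := by
  refine subsingleton_of_forall_eq 0 fun y => ?_
  obtain ⟨z, rfl⟩ := h.exists_pull_of_pull_eq_zero (y := y) (hX.elim _ _)
  rw [hZ.elim z 0, map_zero]

theorem subsingleton_right (h : SES f g) {n : ℕ} (hX : Subsingleton (Abelian.Ext W X n))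
    (hZ : Subsingleton (Abelian.Ext W Z n)) : Subsingleton (Abelian.Ext W Y n) := by
  refine subsingleton_of_forall_eq 0 fun y => ?_
  obtain ⟨z, rfl⟩ := h.exists_push_of_push_eq_zero (y := y) (hZ.elim _ _)
  rw [hX.elim z 0, map_zero]

end SES

theorem ext_subsingleton_of_subsingleton_left {X W : ModuleCat.{u} A} [Subsingleton X] (n : ℕ) :
    Subsingleton (Abelian.Ext X W n) := by
  refine subsingleton_of_forall_eq 0 fun x => ?_
  rw [← pull_id x, show (LinearMap.id : X →ₗ[A] X) = 0 from
    LinearMap.ext fun y => Subsingleton.elim _ _, pull_zero]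

theorem ext_subsingleton_of_subsingleton_right {X W : ModuleCat.{u} A} [Subsingleton X] (n : ℕ) :
    Subsingleton (Abelian.Ext W X n) := by
  refine subsingleton_of_forall_eq 0 fun x => ?_
  -- The zero map is written as an empty sum so that additivity of `push` yields 0.
  rw [← push_id x, show (LinearMap.id : X →ₗ[A] X) = ∑ i : Fin 0, (Fin.elim0 i) from
    LinearMap.ext fun y => Subsingleton.elim _ _, push_sum]
  simp

theorem ext_subsingleton_of_sum_left {ι : Type*} [Fintype ι] {X W : ModuleCat.{u} A}
    {Y : ι → ModuleCat.{u} A} (α : ∀ i, X →ₗ[A] Y i) (β : ∀ i, Y i →ₗ[A] X)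
    (h : ∑ i, β i ∘ₗ α i = LinearMap.id) {n : ℕ} (hY : ∀ i, Subsingleton (Abelian.Ext (Y i) W n)) :
    Subsingleton (Abelian.Ext X W n) := by
  refine subsingleton_of_forall_eq 0 fun x => ?_
  rw [← pull_id x, ← h, pull_sum]
  refine Finset.sum_eq_zero fun i _ => ?_
  rw [← pull_pull, (hY i).elim (pull (β i) W n x) 0, map_zero]

theorem ext_subsingleton_of_sum_right {ι : Type*} [Fintype ι] {X W : ModuleCat.{u} A}
    {Y : ι → ModuleCat.{u} A} (α : ∀ i, X →ₗ[A] Y i) (β : ∀ i, Y i →ₗ[A] X)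
    (h : ∑ i, β i ∘ₗ α i = LinearMap.id) {n : ℕ} (hY : ∀ i, Subsingleton (Abelian.Ext W (Y i) n)) :
    Subsingleton (Abelian.Ext W X n) := by
  refine subsingleton_of_forall_eq 0 fun x => ?_
  rw [← push_id x, ← h, push_sum]
  refine Finset.sum_eq_zero fun i _ => ?_
  rw [← push_push, (hY i).elim (push (α i) W n x) 0, map_zero]

theorem sum_single_comp_proj {ι : Type*} [Fintype ι] [DecidableEq ι] (X : ι → ModuleCat.{u} A) :
    ∑ i, LinearMap.single A (fun i => (X i : Type u)) i ∘ₗ LinearMap.proj i =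
      (LinearMap.id : (∀ i, X i) →ₗ[A] (∀ i, X i)) := by
  ext x j
  simp

end ExtTools

/-! ### Heights in a finite poset. -/

section Heights

variable {Λ : Type*} [PartialOrder Λ]

theorem remaining_antitone : Antitone (remaining (Λ := Λ)) :=
  antitone_nat_of_succ_le fun _ _ h => h.1

/-- While `x` is present `y` is not minimal, so `y` outlives `x` by at least one layer. -/
theorem mem_remaining_succ_of_lt {x y : Λ} (hxy : x < y) {n : ℕ} (hx : x ∈ remaining n) :
    y ∈ remaining (n + 1) := by
  induction n with
  | zero => exact ⟨trivial, fun hm => (hm.2 hx hxy.le).not_gt hxy⟩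
  | succ n ih => exact ⟨ih hx.1, fun hm => (hm.2 hx hxy.le).not_gt hxy⟩

theorem exists_notMem_remaining [Finite Λ] (x : Λ) : ∃ n, x ∉ remaining n := by
  induction x using WellFoundedLT.induction with
  | ind x ih =>
    choose! N hN using ih
    obtain ⟨B, hB⟩ := (Set.finite_range N).bddAbove
    by_cases hx : x ∈ remaining B
    -- By stage `B` everything below `x` is gone, so `x` is minimal there and is removed next.
    · refine ⟨B + 1, fun h => h.2 ⟨hx, fun y hy hyx => ?_⟩⟩
      by_contra hc
      exact hN y (lt_of_le_not_ge hyx hc) (remaining_antitone (hB ⟨y, rfl⟩) hy)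
    · exact ⟨B, hx⟩

theorem ht_lt_ht [Finite Λ] {x y : Λ} (hxy : x < y) : ht x < ht y := by
  have hy : y ∉ remaining (ht y) := Nat.sInf_mem (exists_notMem_remaining y)
  by_contra! hle
  obtain h0 | ⟨n, hn⟩ : ht y = 0 ∨ ∃ n, ht y = n + 1 := by
    cases ht y <;> simp
  · rw [h0] at hy
    exact hy trivial
  · rw [hn] at hy hle
    have hx : x ∉ remaining n := fun hx => hy (mem_remaining_succ_of_lt hxy hx)
    have : ht x ≤ n := Nat.sInf_le hx
    omega

theorem ht_le_ht [Finite Λ] {x y : Λ} (hxy : x ≤ y) : ht x ≤ ht y := by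
  rcases hxy.eq_or_lt with rfl | h
  · rfl
  · exact (ht_lt_ht h).le

variable (Λ) in
theorem exists_ht_lt [Finite Λ] : ∃ H : ℕ, ∀ x : Λ, ht x < H := by
  obtain ⟨B, hB⟩ := (Set.finite_range (ht : Λ → ℕ)).bddAbove
  exact ⟨B + 1, fun x => Nat.lt_succ_of_le (hB ⟨x, rfl⟩)⟩

end Heights

/-! ### Filtered modules as an inductive class. -/

section Filtered

variable {A : Type u} [Ring A]

namespace SES

/-- The sequence attached to a surjective map. -/
theorem of_surjective {Y Z : ModuleCat.{u} A} {g : Y →ₗ[A] Z} (hg : Function.Surjective g) :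
    SES (X := ModuleCat.of A (LinearMap.ker g)) (LinearMap.ker g).subtype g where
  inj := Subtype.val_injective
  exact := LinearMap.exact_subtype_ker_map g
  surj := hg

variable {X Y Z : ModuleCat.{u} A} {f : X →ₗ[A] Y} {g : Y →ₗ[A] Z}

theorem factor_right (h : SES f g) {W : ModuleCat.{u} A} {φ : Y →ₗ[A] W} (hφ : φ ∘ₗ f = 0) :
    ∃ ψ : Z →ₗ[A] W, ψ ∘ₗ g = φ := by
  obtain ⟨z, hz⟩ := h.exists_pull_of_pull_eq_zero (W := W) (n := 0)
    (y := Abelian.Ext.mk₀ (ModuleCat.ofHom φ))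
    (by rw [pull_mk₀, hφ, mk₀_ofHom_zero])
  obtain ⟨ψ, rfl⟩ := exists_mk₀ z
  rw [pull_mk₀] at hz
  exact ⟨ψ, mk₀_ofHom_injective hz⟩

theorem factor_left (h : SES f g) {W : ModuleCat.{u} A} {φ : W →ₗ[A] Y} (hφ : g ∘ₗ φ = 0) :
    ∃ ψ : W →ₗ[A] X, f ∘ₗ ψ = φ := by
  obtain ⟨z, hz⟩ := h.exists_push_of_push_eq_zero (W := W) (n := 0)
    (y := Abelian.Ext.mk₀ (ModuleCat.ofHom φ))
    (by rw [push_mk₀, hφ, mk₀_ofHom_zero])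
  obtain ⟨ψ, rfl⟩ := exists_mk₀ z
  rw [push_mk₀] at hz
  exact ⟨ψ, mk₀_ofHom_injective hz⟩

/-- For `Y → Z → T` surjective the kernels form a short exact sequence. -/
theorem ker_comp (h : SES f g) {N T : ModuleCat.{u} A} {i : N →ₗ[A] Z} {p : Z →ₗ[A] T}
    (h' : SES i p) : ∃ (V : ModuleCat.{u} A) (j : V →ₗ[A] Y) (a : X →ₗ[A] V) (b : V →ₗ[A] N),
      SES j (p ∘ₗ g) ∧ SES a b ∧ j ∘ₗ a = f ∧ i ∘ₗ b = g ∘ₗ j := by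
  have hj := of_surjective (g := p ∘ₗ g) (h'.surj.comp h.surj)
  let V := LinearMap.ker (p ∘ₗ g)
  have hb : ∀ v : V, ∃ n, i n = g v := fun v => (h'.exact (g v)).1 v.2
  choose b hb using hb
  refine ⟨ModuleCat.of A V, V.subtype, f.codRestrict V fun x => ?_,
    { toFun := b, map_add' := fun v w => ?_, map_smul' := fun r v => ?_ }, hj, ⟨?_, ?_, ?_⟩,
    rfl, LinearMap.ext hb⟩
  · simp [V, h.exact.apply_apply_eq_zero]
  · apply h'.inj; simp [hb]
  · apply h'.inj; simp [hb]
  · intro x y hxy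
    exact h.inj (congrArg Subtype.val hxy)
  · intro v
    constructor
    · intro hv
      have : g v = 0 := by rw [← hb v]; exact (congrArg i hv).trans (map_zero i)
      obtain ⟨x, hx⟩ := (h.exact _).1 this
      exact ⟨x, Subtype.ext hx⟩
    · rintro ⟨x, rfl⟩
      apply h'.inj
      refine (hb _).trans ((h.exact.apply_apply_eq_zero x).trans (map_zero i).symm)
  · intro n
    obtain ⟨y, hy⟩ := h.surj (i n)
    refine ⟨⟨y, ?_⟩, h'.inj ((hb _).trans hy)⟩
    simp [V, hy, h'.exact.apply_apply_eq_zero]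

/-- For `N → X → Y` injective the cokernels form a short exact sequence. -/
theorem coker_comp (h : SES f g) {N T : ModuleCat.{u} A} {i : N →ₗ[A] X} {p : X →ₗ[A] T}
    (h' : SES i p) : ∃ (V : ModuleCat.{u} A) (q : Y →ₗ[A] V) (a : T →ₗ[A] V) (b : V →ₗ[A] Z),
      SES (f ∘ₗ i) q ∧ SES a b ∧ b ∘ₗ q = g ∧ a ∘ₗ p = q ∘ₗ f := by
  let R := LinearMap.range (f ∘ₗ i)
  have ha : ∀ t : T, ∃ x, p x = t := h'.surj
  have hfi : ∀ x, p x = 0 ↔ R.mkQ (f x) = 0 := fun x => by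
    rw [Submodule.mkQ_apply, Submodule.Quotient.mk_eq_zero, h'.exact x]
    constructor
    · rintro ⟨n, rfl⟩
      exact ⟨n, rfl⟩
    · rintro ⟨n, hn⟩
      exact ⟨n, h.inj hn⟩
  choose s hs using ha
  have key : ∀ x x', p x = p x' → R.mkQ (f x) = R.mkQ (f x') := fun x x' hx => by
    rw [← sub_eq_zero, ← map_sub, ← map_sub, ← hfi, map_sub, hx, sub_self]
  let a : T →ₗ[A] (Y ⧸ R) :=
    { toFun := fun t => R.mkQ (f (s t))
      map_add' := fun t t' => by
        rw [← map_add, ← map_add]; exact key _ _ (by rw [map_add, hs, hs, hs])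
      map_smul' := fun r t => by
        rw [RingHom.id_apply, ← map_smul, ← map_smul]
        exact key _ _ (by rw [map_smul, hs, hs]) }
  refine ⟨ModuleCat.of A (Y ⧸ R), R.mkQ, a, R.liftQ g ?_,
    ⟨h.inj.comp h'.inj, fun y => ?_, R.mkQ_surjective⟩, ⟨?_, ?_, ?_⟩, R.liftQ_mkQ g _,
    LinearMap.ext fun x => key _ _ (hs _)⟩
  · rintro _ ⟨n, rfl⟩
    exact h.exact.apply_apply_eq_zero _
  · rw [Submodule.mkQ_apply, Submodule.Quotient.mk_eq_zero]
    rfl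
  · refine (injective_iff_map_eq_zero a).2 fun t ht => ?_
    rw [← hs t, hfi]
    exact ht
  · intro v
    obtain ⟨y, rfl⟩ := R.mkQ_surjective v
    constructor
    · intro hy
      obtain ⟨x, rfl⟩ := (h.exact y).1 hy
      exact ⟨p x, key _ _ (hs _)⟩
    · rintro ⟨t, ht⟩
      rw [← ht]
      exact h.exact.apply_apply_eq_zero _
  · intro z
    obtain ⟨y, rfl⟩ := h.surj z
    exact ⟨R.mkQ y, rfl⟩

end SES

variable {Λ : Type u}

/-- `M` has a finite filtration with factors isomorphic to some `Θ μ`, `μ ∈ S`. -/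
inductive Filt (Θ : Λ → ModuleCat.{u} A) (S : Set Λ) : ModuleCat.{u} A → Prop
  | zero (M : ModuleCat.{u} A) (h : Subsingleton M) : Filt Θ S M
  | step {N M : ModuleCat.{u} A} {μ : Λ} (hμ : μ ∈ S) {f : N →ₗ[A] M} {g : M →ₗ[A] Θ μ}
      (h : SES f g) (hN : Filt Θ S N) : Filt Θ S M

variable {Θ : Λ → ModuleCat.{u} A} {S : Set Λ}

namespace Filt

theorem of_equiv {M M' : ModuleCat.{u} A} (hM : Filt Θ S M) (e : M ≃ₗ[A] M') : Filt Θ S M' := by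
  cases hM with
  | zero _ h => exact .zero _ e.symm.toEquiv.subsingleton
  | step hμ h hN =>
    refine .step (f := e.toLinearMap ∘ₗ _) (g := _ ∘ₗ e.symm.toLinearMap) hμ
      ⟨e.injective.comp h.inj, fun y => ?_, h.surj.comp e.symm.surjective⟩ hN
    rw [LinearMap.comp_apply, LinearEquiv.coe_coe, h.exact]
    constructor
    · rintro ⟨x, hx⟩
      exact ⟨x, by simp [hx]⟩
    · rintro ⟨x, hx⟩
      exact ⟨x, by simp [← hx]⟩

theorem mono {S' : Set Λ} (hS : S ⊆ S') {M : ModuleCat.{u} A} (hM : Filt Θ S M) :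
    Filt Θ S' M := by
  induction hM with
  | zero _ h => exact .zero _ h
  | step hμ h _ ih => exact .step (hS hμ) h ih

theorem single {μ : Λ} (hμ : μ ∈ S) : Filt Θ S (Θ μ) :=
  .step (N := ModuleCat.of A PUnit) (f := 0) (g := LinearMap.id) hμ
    ⟨Function.injective_of_subsingleton _, fun y => ⟨fun h => ⟨0, h.symm⟩, by
      rintro ⟨x, rfl⟩; rfl⟩, Function.surjective_id⟩ (.zero _ inferInstance)

theorem extension {X Y Z : ModuleCat.{u} A} {f : X →ₗ[A] Y} {g : Y →ₗ[A] Z} (h : SES f g)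
    (hX : Filt Θ S X) (hZ : Filt Θ S Z) : Filt Θ S Y := by
  induction hZ generalizing Y with
  | zero Z hZ =>
    refine hX.of_equiv (LinearEquiv.ofBijective f ⟨h.inj, fun y => (h.exact y).1 ?_⟩)
    exact Subsingleton.elim _ _
  | step hμ h' _ ih =>
    obtain ⟨V, j, a, b, hj, hab, -⟩ := h.ker_comp h'
    exact .step hμ hj (ih hab)

end Filt

/-- A property of modules that holds for zero modules and is closed under extensions is closed
under finite products. -/
theorem pi_induction {P : ModuleCat.{u} A → Prop}
    (h0 : ∀ M : ModuleCat.{u} A, Subsingleton M → P M)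
    (h1 : ∀ {X Y Z : ModuleCat.{u} A} (f : X →ₗ[A] Y) (g : Y →ₗ[A] Z), SES f g → P X → P Z → P Y)
    {ι : Type u} [Finite ι] (M : ι → ModuleCat.{u} A) (hM : ∀ i, P (M i)) :
    P (ModuleCat.of A (∀ i, M i)) := by
  have hiso : ∀ {X Y : ModuleCat.{u} A}, (X ≃ₗ[A] Y) → P X → P Y := fun {X Y} e hX =>
    h1 (Z := ModuleCat.of A PUnit) e.toLinearMap 0 ⟨e.injective, fun y =>
      ⟨fun _ => e.surjective y, fun _ => rfl⟩, fun y => ⟨0, rfl⟩⟩ hX (h0 _ inferInstance)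
  induction ι using Finite.induction_empty_option with
  | of_equiv e ih =>
    exact hiso (X := ModuleCat.of A (∀ i, M (e i)))
      (LinearEquiv.piCongrLeft A (fun i => (M i : Type u)) e) (ih _ fun i => hM _)
  | h_empty => exact h0 _ ⟨fun a b => funext fun i => i.elim⟩
  | h_option ih =>
    let e := LinearEquiv.piOptionEquivProd A (M := fun i => (M i : Type u))
    refine h1 (X := ModuleCat.of A (∀ a, M (some a))) (Z := M none)
      (e.symm.toLinearMap ∘ₗ LinearMap.inr A (M none) (∀ a, M (some a)))
      (LinearMap.fst A (M none) (∀ a, M (some a)) ∘ₗ e.toLinearMap)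
      ⟨e.symm.injective.comp fun x y hxy => (Prod.ext_iff.1 hxy).2, fun y => ?_,
        Prod.fst_surjective.comp e.surjective⟩ (ih _ fun i => hM _) (hM _)
    constructor
    · intro hy
      refine ⟨(e y).2, e.injective ((e.apply_symm_apply _).trans (Prod.ext ?_ rfl))⟩
      exact Eq.symm hy
    · rintro ⟨x, rfl⟩
      simp

namespace Filt

theorem pi {ι : Type u} [Finite ι] (M : ι → ModuleCat.{u} A) (hM : ∀ i, Filt Θ S (M i)) :
    Filt Θ S (ModuleCat.of A (∀ i, M i)) :=
  pi_induction .zero (fun _ _ h => extension h) M hM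

theorem finite (hΘ : ∀ i, Module.Finite A (Θ i)) {M : ModuleCat.{u} A} (hM : Filt Θ S M) :
    Module.Finite A M := by
  induction hM with
  | zero _ h => infer_instance
  | @step N M μ _ f g h _ ih =>
    refine ⟨Submodule.fg_of_fg_map_of_fg_inf_ker g ?_ ?_⟩
    · rw [Submodule.map_top, LinearMap.range_eq_top.2 h.surj]
      exact (hΘ _).fg_top
    · rw [top_inf_eq, h.exact.linearMap_ker_eq, LinearMap.range_eq_map]
      exact ih.fg_top.map _

/-- Passage from chains of submodules to a predicate in which factors are peeled off from the top,
so that later arguments are inductions over short exact sequences. -/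
theorem of_hasFiltration {M : Type u} [AddCommGroup M] [Module A M] (h : HasFiltration Θ S M) :
    Filt Θ S (ModuleCat.of A M) := by
  obtain ⟨n, F, h0, hn, hmono, hF⟩ := h
  have key : ∀ i ≤ n, Filt Θ S (ModuleCat.of A (F i)) := by
    intro i
    induction i with
    | zero =>
      intro _
      rw [h0]
      exact .zero _ inferInstance
    | succ i ih =>
      intro hi
      obtain ⟨μ, hμ, ⟨e⟩⟩ := hF i hi
      refine .step (N := ModuleCat.of A (F i)) hμ
        (f := Submodule.inclusion (hmono i.le_succ)) (g := e.toLinearMap ∘ₗ Submodule.mkQ _)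
        ⟨Submodule.inclusion_injective _, fun y => ?_,
          e.surjective.comp (Submodule.mkQ_surjective _)⟩ (ih (by omega))
      rw [LinearMap.comp_apply, LinearEquiv.coe_coe, LinearEquiv.map_eq_zero_iff,
        Submodule.mkQ_apply, Submodule.Quotient.mk_eq_zero]
      change (y : M) ∈ F i ↔ _
      constructor
      · intro hy
        exact ⟨⟨_, hy⟩, rfl⟩
      · rintro ⟨x, rfl⟩
        exact x.2
  have := key n le_rfl
  rw [hn] at this
  exact this.of_equiv Submodule.topEquiv

theorem hom_eq_zero_left {M W : ModuleCat.{u} A} (hM : Filt Θ S M)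
    (hW : ∀ μ ∈ S, ∀ φ : Θ μ →ₗ[A] W, φ = 0) (φ : M →ₗ[A] W) : φ = 0 := by
  induction hM with
  | zero _ h => exact LinearMap.ext fun x => by rw [Subsingleton.elim x 0]; simp
  | @step N M μ hμ f g h _ ih =>
    have h0 := ih (φ ∘ₗ f)
    obtain ⟨ψ, rfl⟩ := h.factor_right h0
    rw [hW μ hμ ψ, LinearMap.zero_comp]

/-- Composing with the top factor gives `g ∘ φ = g ∘ φ ∘ e = 0`, so `φ` drops to the next step of
the filtration, where the argument repeats. Applied to an idempotent `e`, this removes superfluous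
summands of covers. -/
theorem hom_eq_zero_of_comp {X M : ModuleCat.{u} A} (hM : Filt Θ S M) (e : X →ₗ[A] X)
    (he : ∀ μ ∈ S, ∀ ψ : X →ₗ[A] Θ μ, ψ ∘ₗ e = 0) (φ : X →ₗ[A] M) (hφ : φ ∘ₗ e = φ) : φ = 0 := by
  induction hM with
  | zero _ h => exact LinearMap.ext fun x => Subsingleton.elim _ _
  | @step N M μ hμ f g h _ ih =>
    have h0 : g ∘ₗ φ = 0 := by
      rw [← he μ hμ (g ∘ₗ φ), LinearMap.comp_assoc, hφ]
    obtain ⟨φ', h1⟩ := h.factor_left h0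
    have h2 : φ' = 0 := ih φ' (LinearMap.ext fun x => h.inj (by
      have := LinearMap.congr_fun hφ x
      rw [← h1] at this
      exact this))
    rw [← h1, h2, LinearMap.comp_zero]

theorem hom_eq_zero_right {X M : ModuleCat.{u} A} (hM : Filt Θ S M)
    (hX : ∀ μ ∈ S, ∀ φ : X →ₗ[A] Θ μ, φ = 0) (φ : X →ₗ[A] M) : φ = 0 :=
  hM.hom_eq_zero_of_comp LinearMap.id (fun μ hμ _ => hX μ hμ _) φ rfl

theorem ext_left {M W : ModuleCat.{u} A} {n : ℕ} (hM : Filt Θ S M)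
    (hW : ∀ μ ∈ S, Subsingleton (Abelian.Ext (Θ μ) W n)) : Subsingleton (Abelian.Ext M W n) := by
  induction hM with
  | zero _ h => exact ext_subsingleton_of_subsingleton_left n
  | step hμ h _ ih => exact h.subsingleton_left ih (hW _ hμ)

theorem ext_right {M W : ModuleCat.{u} A} {n : ℕ} (hM : Filt Θ S M)
    (hW : ∀ μ ∈ S, Subsingleton (Abelian.Ext W (Θ μ) n)) : Subsingleton (Abelian.Ext W M n) := by
  induction hM with
  | zero _ h => exact ext_subsingleton_of_subsingleton_right n
  | step hμ h _ ih => exact h.subsingleton_right ih (hW _ hμ)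

end Filt

end Filtered

/-! ### Split sequences, summands and radicals. -/

section Splitting

variable {A : Type u} [Ring A]

namespace SES

variable {X Y Z : ModuleCat.{u} A} {f : X →ₗ[A] Y} {g : Y →ₗ[A] Z}

/-- A retraction of a short exact sequence gives a section. -/
theorem exists_section (h : SES f g) {r : Y →ₗ[A] X} (hr : r ∘ₗ f = LinearMap.id) :
    ∃ s : Z →ₗ[A] Y, SES s r ∧ g ∘ₗ s = LinearMap.id ∧ s ∘ₗ g = LinearMap.id - f ∘ₗ r := by
  have hrf : ∀ x, r (f x) = x := LinearMap.congr_fun hr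
  obtain ⟨s, hs⟩ := h.factor_right (W := Y) (φ := LinearMap.id - f ∘ₗ r)
    (LinearMap.ext fun x => by simp [hrf])
  have hsg : ∀ y, s (g y) = y - f (r y) := LinearMap.congr_fun hs
  have hgs : ∀ z, g (s z) = z := fun z => by
    obtain ⟨y, rfl⟩ := h.surj z
    rw [hsg, map_sub, h.exact.apply_apply_eq_zero, sub_zero]
  refine ⟨s, ⟨Function.LeftInverse.injective hgs, fun y => ⟨fun hy => ⟨g y, ?_⟩, ?_⟩,
    fun x => ⟨f x, hrf x⟩⟩, LinearMap.ext hgs, hs⟩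
  · rw [hsg, hy, map_zero, sub_zero]
  · rintro ⟨z, rfl⟩
    obtain ⟨y, rfl⟩ := h.surj z
    rw [hsg, map_sub, hrf, sub_self]

theorem subsingleton_of_right (h : SES f g) [Subsingleton Y] : Subsingleton X :=
  h.inj.subsingleton

/-- The kernel of the second map of a short exact sequence is the first module. -/
def equivKer (h : SES f g) : X ≃ₗ[A] LinearMap.ker g :=
  (LinearEquiv.ofInjective f h.inj).trans
    (LinearEquiv.ofEq _ _ h.exact.linearMap_ker_eq.symm)

/-- The left map of a morphism of short exact sequences which is determined by the middle one. -/
theorem exists_left {X' Y' Z' : ModuleCat.{u} A} {f' : X' →ₗ[A] Y'} {g' : Y' →ₗ[A] Z'}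
    (h : SES f g) (h' : SES f' g') (φ : Y →ₗ[A] Y') (h0 : ∀ ψ : X →ₗ[A] Z', ψ = 0) :
    ∃ (a : X →ₗ[A] X') (b : Z →ₗ[A] Z'), f' ∘ₗ a = φ ∘ₗ f ∧ b ∘ₗ g = g' ∘ₗ φ := by
  obtain ⟨a, ha⟩ := h'.factor_left (φ := φ ∘ₗ f) (h0 _)
  obtain ⟨b, hb⟩ := h.factor_right (φ := g' ∘ₗ φ) (by
    rw [LinearMap.comp_assoc]; exact h0 _)
  exact ⟨a, b, ha, hb⟩

/-- The kernels of a morphism of short exact sequences whose left component is surjective. -/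
theorem kernels {X' Y' Z' : ModuleCat.{u} A} {f' : X' →ₗ[A] Y'} {g' : Y' →ₗ[A] Z'}
    (h : SES f g) (h' : SES f' g') {a : X →ₗ[A] X'} {φ : Y →ₗ[A] Y'} {b : Z →ₗ[A] Z'}
    (ha : f' ∘ₗ a = φ ∘ₗ f) (hb : b ∘ₗ g = g' ∘ₗ φ) (hsurj : Function.Surjective a) :
    ∃ (i : LinearMap.ker a →ₗ[A] LinearMap.ker φ) (p : LinearMap.ker φ →ₗ[A] LinearMap.ker b),
      SES (X := ModuleCat.of A (LinearMap.ker a)) (Y := ModuleCat.of A (LinearMap.ker φ))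
        (Z := ModuleCat.of A (LinearMap.ker b)) i p := by
  have ha' : ∀ x, f' (a x) = φ (f x) := LinearMap.congr_fun ha
  have hb' : ∀ x, b (g x) = g' (φ x) := LinearMap.congr_fun hb
  refine ⟨f.restrict (p := LinearMap.ker a) (q := LinearMap.ker φ) fun x hx => ?_,
    g.restrict (p := LinearMap.ker φ) (q := LinearMap.ker b) fun y hy => ?_, ?_, ?_, ?_⟩
  · rw [LinearMap.mem_ker] at hx ⊢
    rw [← ha', hx, map_zero]
  · rw [LinearMap.mem_ker] at hy ⊢
    rw [hb', hy, map_zero]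
  · intro x y hxy
    exact Subtype.ext (h.inj (congrArg Subtype.val hxy))
  · intro y
    constructor
    · intro hy
      obtain ⟨x, hx⟩ := (h.exact y.1).1 (congrArg Subtype.val hy)
      refine ⟨⟨x, h'.inj ?_⟩, Subtype.ext hx⟩
      rw [ha', hx, map_zero]
      exact y.2
    · rintro ⟨x, rfl⟩
      exact Subtype.ext (h.exact.apply_apply_eq_zero _)
  · intro z
    obtain ⟨y, hy⟩ := h.surj z.1
    have hz : g' (φ y) = 0 := by rw [← hb', hy]; exact z.2
    obtain ⟨x', hx'⟩ := (h'.exact _).1 hz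
    obtain ⟨x, rfl⟩ := hsurj x'
    refine ⟨⟨y - f x, ?_⟩, Subtype.ext ?_⟩
    · rw [LinearMap.mem_ker, map_sub, ← hx', ha', sub_self]
    · change g (y - f x) = z
      rw [map_sub, h.exact.apply_apply_eq_zero, sub_zero, hy]

end SES

/-- `X` is a direct summand of a finite direct sum of copies of `W`. -/
def IsSummand (W X : ModuleCat.{u} A) : Prop :=
  ∃ (ι : Type u) (_ : Fintype ι) (α : ι → X →ₗ[A] W) (β : ι → W →ₗ[A] X),
    ∑ i, β i ∘ₗ α i = LinearMap.id

namespace IsSummand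

variable {W : ModuleCat.{u} A}

theorem of_subsingleton (X : ModuleCat.{u} A) [Subsingleton X] : IsSummand W X :=
  ⟨PEmpty, inferInstance, fun i => i.elim, fun i => i.elim,
    LinearMap.ext fun _ => Subsingleton.elim _ _⟩

theorem of_sum {ι : Type u} [Fintype ι] {X : ModuleCat.{u} A} {Y : ι → ModuleCat.{u} A}
    (α : ∀ i, X →ₗ[A] Y i) (β : ∀ i, Y i →ₗ[A] X) (h : ∑ i, β i ∘ₗ α i = LinearMap.id)
    (hY : ∀ i, IsSummand W (Y i)) : IsSummand W X := by
  choose κ hκ a b hab using hY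
  refine ⟨Σ i, κ i, inferInstance, fun x => a x.1 x.2 ∘ₗ α x.1, fun x => β x.1 ∘ₗ b x.1 x.2, ?_⟩
  rw [Fintype.sum_sigma, ← h]
  refine Finset.sum_congr rfl fun i _ => LinearMap.ext fun x => ?_
  have := congrArg (β i) (LinearMap.congr_fun (hab i) (α i x))
  simpa using this

theorem of_add {X Y Z : ModuleCat.{u} A} {f : Y →ₗ[A] X} {r : X →ₗ[A] Y} {s : Z →ₗ[A] X}
    {g : X →ₗ[A] Z} (h : f ∘ₗ r + s ∘ₗ g = LinearMap.id) (hY : IsSummand W Y)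
    (hZ : IsSummand W Z) : IsSummand W X := by
  obtain ⟨κ, _, a, b, hab⟩ := hY
  obtain ⟨κ', _, a', b', hab'⟩ := hZ
  refine ⟨κ ⊕ κ', inferInstance, Sum.elim (fun i => a i ∘ₗ r) (fun i => a' i ∘ₗ g),
    Sum.elim (fun i => f ∘ₗ b i) (fun i => s ∘ₗ b' i), ?_⟩
  rw [Fintype.sum_sum_type, ← h]
  ext x
  have h1 := congrArg f (LinearMap.congr_fun hab (r x))
  have h2 := congrArg s (LinearMap.congr_fun hab' (g x))
  simp only [LinearMap.sum_apply, LinearMap.comp_apply, map_sum, LinearMap.id_apply] at h1 h2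
  simp [h1, h2]

theorem pi {ι : Type u} [Finite ι] (X : ι → ModuleCat.{u} A) (hX : ∀ i, IsSummand W (X i)) :
    IsSummand W (ModuleCat.of A (∀ i, X i)) := by
  classical
  have := Fintype.ofFinite ι
  exact of_sum _ _ (sum_single_comp_proj X) hX

theorem component {Λ : Type u} [Finite Λ] (Θ : Λ → ModuleCat.{u} A) (i : Λ) :
    IsSummand (total Θ) (Θ i) := by
  classical
  refine ⟨PUnit, inferInstance, fun _ => LinearMap.single A (fun i => (Θ i : Type u)) i,
    fun _ => LinearMap.proj i, ?_⟩
  ext x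
  simp

theorem ext_left {X V : ModuleCat.{u} A} {n : ℕ} (hX : IsSummand W X)
    (hW : Subsingleton (Abelian.Ext W V n)) : Subsingleton (Abelian.Ext X V n) := by
  obtain ⟨ι, _, α, β, h⟩ := hX
  exact ext_subsingleton_of_sum_left α β h fun _ => hW

theorem ext_right {X V : ModuleCat.{u} A} {n : ℕ} (hX : IsSummand W X)
    (hW : Subsingleton (Abelian.Ext V W n)) : Subsingleton (Abelian.Ext V X n) := by
  obtain ⟨ι, _, α, β, h⟩ := hX
  exact ext_subsingleton_of_sum_right α β h fun _ => hW

end IsSummand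

/-- A submodule which together with the radical generates a finitely generated module. -/
theorem eq_top_of_sup_jacobson {M : Type u} [AddCommGroup M] [Module A M] [Module.Finite A M]
    {N : Submodule A M} (h : N ⊔ Module.jacobson A M = ⊤) : N = ⊤ := by
  by_contra hN
  obtain ⟨m, hm, hNm⟩ := (eq_top_or_exists_le_coatom N).resolve_left hN
  exact hm.1 (top_le_iff.1 (h ▸ sup_le hNm (sInf_le hm)))

/-- A simple top makes the radical the largest proper submodule. -/
theorem le_jacobson_of_ne_top {M : Type u} [AddCommGroup M] [Module A M] [Module.Finite A M]
    (hM : IsSimpleModule A (TopOf A M)) {N : Submodule A M} (hN : N ≠ ⊤) :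
    N ≤ Module.jacobson A M := by
  rcases eq_bot_or_eq_top (N.map (Module.jacobson A M).mkQ) with h | h
  · rwa [← LinearMap.le_ker_iff_map, Submodule.ker_mkQ] at h
  · refine absurd (eq_top_of_sup_jacobson ?_) hN
    have := congrArg (Submodule.comap (Module.jacobson A M).mkQ) h
    rwa [Submodule.comap_map_mkQ, Submodule.comap_top, sup_comm] at this

/-- A nonzero map from a module with simple top to a simple module induces an isomorphism on
tops. -/
theorem nonempty_topOf_equiv {M C : Type u} [AddCommGroup M] [Module A M]
    [AddCommGroup C] [Module A C] (hM : IsSimpleModule A (TopOf A M)) [IsSimpleModule A C]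
    {φ : M →ₗ[A] C} (hφ : φ ≠ 0) : Nonempty (TopOf A M ≃ₗ[A] C) := by
  have hle : Module.jacobson A M ≤ LinearMap.ker φ := by
    refine (Module.le_comap_jacobson φ).trans ?_
    rw [IsSemisimpleModule.jacobson_eq_bot A C]
    rfl
  let ψ := (Module.jacobson A M).liftQ φ hle
  have hψ : ψ ≠ 0 := fun h => hφ (by
    rw [← Submodule.liftQ_mkQ _ φ hle]
    change ψ ∘ₗ _ = 0
    rw [h, LinearMap.zero_comp])
  exact ⟨LinearEquiv.ofBijective ψ (LinearMap.bijective_of_ne_zero hψ)⟩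

end Splitting

/-! ### Layers by height, and closure of 𝓕(Θ) under kernels of surjections. -/

section Stratified

variable {A : Type u} [Ring A] {Λ : Type u} [PartialOrder Λ]

/-- The properties of the modules `Θ_i` of a stratifying system with simple, pairwise non-isomorphic
tops that do not involve the relative projective modules. -/
structure IsStratified (Θ : Λ → ModuleCat.{u} A) : Prop where
  finite : ∀ i, Module.Finite A (Θ i)
  hom_eq_zero : ∀ i j, ¬ i ≤ j → ∀ f : Θ i →ₗ[A] Θ j, f = 0
  ext_eq_zero : ∀ i j, ¬ i < j → Subsingleton (Abelian.Ext (Θ i) (Θ j) 1)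
  top_simple : ∀ i, IsSimpleModule A (TopOf A (Θ i))
  top_ne : ∀ i j, i ≠ j → IsEmpty (TopOf A (Θ i) ≃ₗ[A] TopOf A (Θ j))

/-- The elements of height `j`. -/
def atHt (Λ : Type u) [PartialOrder Λ] (j : ℕ) : Set Λ := {x | ht x = j}

/-- The elements of height at least `j`. -/
def geHt (Λ : Type u) [PartialOrder Λ] (j : ℕ) : Set Λ := {x | j ≤ ht x}

theorem atHt_subset_geHt (j : ℕ) : atHt Λ j ⊆ geHt Λ j := fun _ hx => hx.ge

theorem geHt_succ_subset (j : ℕ) : geHt Λ (j + 1) ⊆ geHt Λ j := fun _ hx => Nat.le_of_succ_le hx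

variable {Θ : Λ → ModuleCat.{u} A}

theorem Filt.subsingleton_of_ht_lt {j : ℕ} (hj : ∀ x : Λ, ht x < j) {M : ModuleCat.{u} A}
    (hM : Filt Θ (geHt Λ j) M) : Subsingleton M := by
  cases hM with
  | zero _ h => exact h
  | step hμ => exact absurd hμ (not_le.2 (hj _))

namespace IsStratified

variable [Finite Λ] (hΘ : IsStratified Θ)

include hΘ in
theorem hom_succ_eq_zero {j : ℕ} {M T : ModuleCat.{u} A} (hM : Filt Θ (geHt Λ (j + 1)) M)
    (hT : Filt Θ (atHt Λ j) T) (φ : M →ₗ[A] T) : φ = 0 := by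
  refine hM.hom_eq_zero_left (fun μ hμ ψ => ?_) φ
  refine hT.hom_eq_zero_right (fun ν hν χ => hΘ.hom_eq_zero μ ν (fun h => ?_) χ) ψ
  have := ht_le_ht h
  have h1 : j + 1 ≤ ht μ := hμ
  have h2 : ht ν = j := hν
  omega

include hΘ in
-- A nonzero Ext¹ between `Θ`'s strictly raises the height, while all factors of `Z` already lie in
-- height at least `j`.
theorem ext_one {j : ℕ} {Z T : ModuleCat.{u} A} (hZ : Filt Θ (geHt Λ j) Z)
    (hT : Filt Θ (atHt Λ j) T) : Subsingleton (Abelian.Ext Z T 1) := by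
  refine hZ.ext_left fun μ hμ => hT.ext_right fun ν hν => hΘ.ext_eq_zero μ ν fun h => ?_
  have := ht_lt_ht h
  have h1 : j ≤ ht μ := hμ
  have h2 : ht ν = j := hν
  omega

include hΘ in
-- Factors of height `j` can be moved to the top of the filtration, because a higher factor lying
-- above them splits off.
theorem exists_layer {j : ℕ} {M : ModuleCat.{u} A} (hM : Filt Θ (geHt Λ j) M) :
    ∃ (N T : ModuleCat.{u} A) (i : N →ₗ[A] M) (p : M →ₗ[A] T), SES i p ∧
      Filt Θ (geHt Λ (j + 1)) N ∧ Filt Θ (atHt Λ j) T := by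
  induction hM with
  | zero M h =>
    exact ⟨M, ModuleCat.of A PUnit, LinearMap.id, 0, ⟨Function.injective_id, fun y =>
      ⟨fun _ => ⟨y, rfl⟩, fun _ => rfl⟩, fun y => ⟨0, rfl⟩⟩, .zero _ h, .zero _ inferInstance⟩
  | @step N M μ hμ f g h _ ih =>
    obtain ⟨N', T, i, p, h', hN', hT⟩ := ih
    obtain ⟨V, q, a, b, hq, hab, -⟩ := h.coker_comp h'
    rcases (show j ≤ ht μ from hμ).eq_or_lt with hj | hj
    · exact ⟨N', V, _, q, hq, hN', hT.extension hab (Filt.single hj.symm)⟩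
    -- The extension of `Θ μ` by `T` splits, so `T` remains a quotient of `M` and `Θ μ` is absorbed
    -- into the kernel.
    · obtain ⟨r, hr⟩ := hab.extend (hΘ.ext_one (Filt.single hμ) hT) LinearMap.id
      obtain ⟨s, hs, -⟩ := hab.exists_section hr
      obtain ⟨V', v, a', b', hv, hab', -⟩ := hq.ker_comp hs
      exact ⟨V', T, v, _, hv, hN'.extension hab' (Filt.single hj), hT⟩

include hΘ in
-- There are no extensions within one height, so a layer is a direct sum.
theorem isSummand {j : ℕ} {T : ModuleCat.{u} A} (hT : Filt Θ (atHt Λ j) T) :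
    IsSummand (total Θ) T := by
  induction hT with
  | zero T h => exact .of_subsingleton T
  | @step N T μ hμ f g h hN ih =>
    obtain ⟨r, hr⟩ := h.extend
      (hΘ.ext_one (Filt.single (atHt_subset_geHt j hμ)) hN) LinearMap.id
    obtain ⟨s, -, -, hs⟩ := h.exists_section hr
    exact .of_add (by rw [hs, add_sub_cancel]) ih (.component Θ μ)

omit [Finite Λ] in
include hΘ in
theorem eq_of_surjective {μ ν : Λ} {φ : Θ ν →ₗ[A] Θ μ} (hφ : Function.Surjective φ) : ν = μ := by
  by_contra hne
  have := hΘ.top_simple μ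
  obtain ⟨e⟩ := nonempty_topOf_equiv (hΘ.top_simple ν)
    (φ := (Module.jacobson A (Θ μ)).mkQ ∘ₗ φ) fun h0 => by
      have : Nontrivial (TopOf A (Θ μ)) := IsSimpleModule.nontrivial A _
      obtain ⟨x, hx⟩ := exists_ne (0 : TopOf A (Θ μ))
      obtain ⟨y, rfl⟩ := (Submodule.mkQ_surjective _).comp hφ x
      exact hx (LinearMap.congr_fun h0 y)
  exact (hΘ.top_ne ν μ hne).false e

variable [IsNoetherianRing A]

include hΘ in
theorem filt_ker_single {j : ℕ} {U V : ModuleCat.{u} A} {μ : Λ} {v : V →ₗ[A] U}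
    {φ : U →ₗ[A] Θ μ} (hU : Filt Θ (atHt Λ j) U) (hv : SES v φ) :
    Filt Θ (atHt Λ j) V := by
  induction hU generalizing V with
  | zero U h => exact .zero _ hv.subsingleton_of_right
  | @step N U ν hν f g h hN ih =>
    have := hΘ.finite
    by_cases hs : Function.Surjective (φ ∘ₗ f)
    · have h1 : Filt Θ (atHt Λ j) (ModuleCat.of A (LinearMap.ker (φ ∘ₗ f))) :=
        ih (SES.of_surjective hs)
      obtain ⟨i, p, hip⟩ := h.kernels (X' := Θ μ) (Y' := Θ μ) (Z' := ModuleCat.of A PUnit)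
        (f' := LinearMap.id) (g' := 0) ⟨Function.injective_id, fun y =>
          ⟨fun _ => ⟨y, rfl⟩, fun _ => rfl⟩, fun y => ⟨0, rfl⟩⟩ (a := φ ∘ₗ f) (φ := φ) (b := 0)
        rfl rfl hs
      refine Filt.of_equiv (Filt.extension hip h1 ?_) hv.equivKer.symm
      refine (Filt.single hν).of_equiv ((LinearEquiv.ofTop _ LinearMap.ker_zero).symm)
    -- Now `N` lands in the radical of `Θ μ`, so the complement `Θ ν` must map onto `Θ μ`. Comparing
    -- tops gives `ν = μ`, noetherianity makes this surjection bijective, and the kernel of `φ`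
    -- projects isomorphically to `N`.
    · obtain ⟨r, hr⟩ := h.extend
        (hΘ.ext_one (Filt.single (atHt_subset_geHt j hν)) hN) LinearMap.id
      obtain ⟨s, hs', -, hsg⟩ := h.exists_section hr
      have hsurj : Function.Surjective (φ ∘ₗ s) := by
        rw [← LinearMap.range_eq_top]
        refine eq_top_of_sup_jacobson (top_le_iff.1 fun y _ => ?_)
        obtain ⟨x, rfl⟩ := hv.surj y
        have hx : x = s (g x) + f (r x) := by
          have := LinearMap.congr_fun hsg x
          simp only [LinearMap.comp_apply, LinearMap.sub_apply, LinearMap.id_apply] at this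
          rw [this, sub_add_cancel]
        rw [hx, map_add]
        refine Submodule.add_mem_sup ⟨g x, rfl⟩ ?_
        exact le_jacobson_of_ne_top (hΘ.top_simple μ)
          (mt LinearMap.range_eq_top.1 hs) ⟨r x, rfl⟩
      obtain rfl := hΘ.eq_of_surjective hsurj
      have hinj := IsNoetherian.injective_of_surjective_endomorphism _ hsurj
      refine hN.of_equiv (LinearEquiv.ofBijective (r ∘ₗ v) ⟨?_, fun x => ?_⟩).symm
      · refine (injective_iff_map_eq_zero _).2 fun x hx => ?_
        obtain ⟨t, ht⟩ := (hs'.exact _).1 hx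
        have h0 : (φ ∘ₗ s) t = 0 := by
          rw [LinearMap.comp_apply, ht]
          exact hv.exact.apply_apply_eq_zero x
        have h1 : t = 0 := (injective_iff_map_eq_zero _).1 hinj t h0
        rw [h1, map_zero] at ht
        exact hv.inj (ht.symm.trans (map_zero v).symm)
      · obtain ⟨u, rfl⟩ := hs'.surj x
        obtain ⟨t, ht⟩ := hsurj (φ u)
        obtain ⟨w, hw⟩ := (hv.exact (u - s t)).1 (by
          rw [map_sub, ← ht, LinearMap.comp_apply, sub_self])
        refine ⟨w, ?_⟩
        rw [LinearMap.comp_apply, hw, map_sub, hs'.exact.apply_apply_eq_zero, sub_zero]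

include hΘ in
theorem filt_ker_layer {j : ℕ} {X Y Z : ModuleCat.{u} A} {f : X →ₗ[A] Y} {g : Y →ₗ[A] Z}
    (h : SES f g) (hY : Filt Θ (atHt Λ j) Y) (hZ : Filt Θ (atHt Λ j) Z) :
    Filt Θ (atHt Λ j) X := by
  induction hZ generalizing X Y with
  | zero Z hZ =>
    refine hY.of_equiv (LinearEquiv.ofBijective f ⟨h.inj, fun y => (h.exact y).1 ?_⟩).symm
    exact Subsingleton.elim _ _
  | step hμ h' _ ih =>
    obtain ⟨V, v, a, b, hv, hab, -⟩ := h.ker_comp h'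
    exact ih hab (hΘ.filt_ker_single hY hv)

include hΘ in
-- If `a` were not onto, `X'` would have a simple quotient killing its image. By a snake argument
-- that simple is also a quotient of `ker b`, so it is the top both of some `Θ_μ` of height greater
-- than `j` and of some `Θ_ν` of height `j`, which is excluded.
theorem surjective_left {j : ℕ} {X Y Z X' Y' Z' : ModuleCat.{u} A} {f : X →ₗ[A] Y}
    {g : Y →ₗ[A] Z} {f' : X' →ₗ[A] Y'} {g' : Y' →ₗ[A] Z'} (h : SES f g) (h' : SES f' g')
    {a : X →ₗ[A] X'} {φ : Y →ₗ[A] Y'} {b : Z →ₗ[A] Z'} (ha : f' ∘ₗ a = φ ∘ₗ f)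
    (hb : b ∘ₗ g = g' ∘ₗ φ) (hφ : Function.Surjective φ) (hX' : Filt Θ (geHt Λ (j + 1)) X')
    (hZ : Filt Θ (atHt Λ j) Z) (hZ' : Filt Θ (atHt Λ j) Z') : Function.Surjective a := by
  rw [← LinearMap.range_eq_top]
  by_contra hne
  have := hX'.finite hΘ.finite
  obtain ⟨m, hm, ham⟩ := (eq_top_or_exists_le_coatom _).resolve_left hne
  have hC : IsSimpleModule A (X' ⧸ m) := isSimpleModule_iff_isCoatom.2 hm
  have hCn := IsSimpleModule.nontrivial A (X' ⧸ m)
  have hbs : Function.Surjective b := by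
    have : Function.Surjective (b ∘ₗ g) := hb ▸ h'.surj.comp hφ
    exact Function.Surjective.of_comp this
  have hK := hΘ.filt_ker_layer (SES.of_surjective hbs) hZ hZ'
  -- On `V = ker (Y → Z')` the map `φ` takes values in `X'`. This gives a surjection `w` extending
  -- `a`, and `w` modulo `m` kills `X`, hence descends to `ker b`.
  obtain ⟨V, v, i, p, hv, hip, hvi, -⟩ := h.ker_comp (SES.of_surjective hbs)
  obtain ⟨w, hw⟩ := h'.factor_left (φ := φ ∘ₗ v) (by
    rw [← LinearMap.comp_assoc, ← hb]; exact hv.comp_eq_zero)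
  have hw' : ∀ x, f' (w x) = φ (v x) := LinearMap.congr_fun hw
  have hwi : ∀ x, w (i x) = a x := fun x => h'.inj (by
    rw [hw', show v (i x) = f x from LinearMap.congr_fun hvi x]
    exact (LinearMap.congr_fun ha x).symm)
  have hws : Function.Surjective w := fun x' => by
    obtain ⟨y, hy⟩ := hφ (f' x')
    have h0 : (b ∘ₗ g) y = 0 := by
      rw [hb, LinearMap.comp_apply, hy]
      exact h'.exact.apply_apply_eq_zero x'
    obtain ⟨t, rfl⟩ := (hv.exact y).1 h0
    exact ⟨t, h'.inj ((hw' t).trans hy)⟩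
  obtain ⟨δ, hδ⟩ := hip.factor_right (W := ModuleCat.of A (X' ⧸ m)) (φ := m.mkQ ∘ₗ w)
    (LinearMap.ext fun x => by
      refine (congrArg m.mkQ (hwi x)).trans ?_
      exact (Submodule.Quotient.mk_eq_zero _).2 (ham ⟨x, rfl⟩))
  obtain ⟨c, hc⟩ := exists_ne (0 : X' ⧸ m)
  obtain ⟨x', rfl⟩ := m.mkQ_surjective c
  obtain ⟨t, rfl⟩ := hws x'
  have h1 : ¬ ∀ μ ∈ geHt Λ (j + 1), ∀ χ : Θ μ →ₗ[A] ModuleCat.of A (X' ⧸ m), χ = 0 := fun h =>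
    hc (LinearMap.congr_fun (hX'.hom_eq_zero_left h m.mkQ) (w t))
  have h2 : ¬ ∀ ν ∈ atHt Λ j, ∀ χ : Θ ν →ₗ[A] ModuleCat.of A (X' ⧸ m), χ = 0 := fun h => by
    refine hc ((LinearMap.congr_fun hδ t).symm.trans ?_)
    rw [hK.hom_eq_zero_left h δ]
    rfl
  push Not at h1 h2
  obtain ⟨μ, hμ, χ, hχ⟩ := h1
  obtain ⟨ν, hν, ψ, hψ⟩ := h2
  obtain ⟨e⟩ := nonempty_topOf_equiv (hΘ.top_simple μ) hχ
  obtain ⟨e'⟩ := nonempty_topOf_equiv (hΘ.top_simple ν) hψ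
  refine (hΘ.top_ne μ ν ?_).false (e.trans e'.symm)
  rintro rfl
  have h1 : j + 1 ≤ ht μ := hμ
  have h2 : ht μ = j := hν
  omega

include hΘ in
/-- `𝓕(Θ)` is closed under kernels of surjective maps. -/
theorem filt_ker (d : ℕ) {j : ℕ} (hd : ∀ x : Λ, ht x < j + d) {X Y Z : ModuleCat.{u} A}
    {f : X →ₗ[A] Y} {g : Y →ₗ[A] Z} (h : SES f g) (hY : Filt Θ (geHt Λ j) Y)
    (hZ : Filt Θ (geHt Λ j) Z) : Filt Θ (geHt Λ j) X := by
  induction d generalizing j X Y Z with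
  | zero =>
    have := hY.subsingleton_of_ht_lt hd
    exact .zero _ h.subsingleton_of_right
  | succ d ih =>
    -- The map `g` respects the layers. The kernel is then an extension of the kernel on layer `j`
    -- by the kernel on the higher part.
    obtain ⟨Y', TY, iY, pY, hY1, hY', hTY⟩ := hΘ.exists_layer hY
    obtain ⟨Z', TZ, iZ, pZ, hZ1, hZ', hTZ⟩ := hΘ.exists_layer hZ
    obtain ⟨a, b, ha, hb⟩ := hY1.exists_left hZ1 g (hΘ.hom_succ_eq_zero hY' hTZ)
    have has := hΘ.surjective_left hY1 hZ1 ha hb h.surj hZ' hTY hTZ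
    have hbs : Function.Surjective b := by
      have : Function.Surjective (b ∘ₗ pY) := hb ▸ hZ1.surj.comp h.surj
      exact Function.Surjective.of_comp this
    obtain ⟨i, p, hip⟩ := hY1.kernels hZ1 ha hb has
    have h1 := ih (fun x => by have := hd x; omega) (SES.of_surjective has) hY' hZ'
    have h2 := hΘ.filt_ker_layer (SES.of_surjective hbs) hTY hTZ
    exact ((h1.mono (geHt_succ_subset j)).extension hip
      (h2.mono (atHt_subset_geHt j))).of_equiv h.equivKer.symm

end IsStratified

end Stratified

/-! ### Good filtrations: vanishing restriction maps on Ext. -/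

section Good

variable {A : Type u} [Ring A]

/-- The product of a family of linear maps. -/
def piMap {ι : Type u} {X Y : ι → ModuleCat.{u} A} (f : ∀ i, X i →ₗ[A] Y i) :
    ModuleCat.of A (∀ i, X i) →ₗ[A] ModuleCat.of A (∀ i, Y i) :=
  LinearMap.pi fun i => f i ∘ₗ LinearMap.proj i

theorem piMap_apply {ι : Type u} {X Y : ι → ModuleCat.{u} A} (f : ∀ i, X i →ₗ[A] Y i)
    (x : ∀ i, X i) (i : ι) : (piMap f x : ∀ i, Y i) i = f i (x i) := rfl

theorem piMap_injective {ι : Type u} {X Y : ι → ModuleCat.{u} A} {f : ∀ i, X i →ₗ[A] Y i}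
    (hf : ∀ i, Function.Injective (f i)) : Function.Injective (piMap f) :=
  fun _ _ hxy => funext fun i => hf i (congrFun hxy i)

theorem piMap_surjective {ι : Type u} {X Y : ι → ModuleCat.{u} A} {f : ∀ i, X i →ₗ[A] Y i}
    (hf : ∀ i, Function.Surjective (f i)) : Function.Surjective (piMap f) := fun y => by
  choose s hs using hf
  exact ⟨fun i => s i ((y : ∀ i, Y i) i), funext fun i => hs i _⟩

theorem SES.pi {ι : Type u} {X Y Z : ι → ModuleCat.{u} A} {f : ∀ i, X i →ₗ[A] Y i}
    {g : ∀ i, Y i →ₗ[A] Z i} (h : ∀ i, SES (f i) (g i)) : SES (piMap f) (piMap g) where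
  inj := piMap_injective fun i => (h i).inj
  surj := piMap_surjective fun i => (h i).surj
  exact y := by
    constructor
    · intro hy
      have : ∀ i, ∃ x, f i x = (y : ∀ i, Y i) i := fun i => ((h i).exact _).1 (congrFun hy i)
      choose x hx using this
      exact ⟨x, funext hx⟩
    · rintro ⟨x, rfl⟩
      exact funext fun i => (h i).exact.apply_apply_eq_zero _

theorem pull_piMap_eq_zero {ι : Type u} [Finite ι] {X Y : ι → ModuleCat.{u} A}
    {W : ModuleCat.{u} A} {f : ∀ i, X i →ₗ[A] Y i} {n : ℕ} (hf : ∀ i y, pull (f i) W n y = 0)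
    (y : Abelian.Ext (ModuleCat.of A (∀ i, Y i)) W n) : pull (piMap f) W n y = 0 := by
  classical
  have := Fintype.ofFinite ι
  have hid : y = ∑ i, pull (X := ModuleCat.of A (∀ i, Y i)) (LinearMap.proj i) W n
      (pull (X := Y i) (Y := ModuleCat.of A (∀ i, Y i))
        (LinearMap.single A (fun i => (Y i : Type u)) i) W n y) := by
    simp only [pull_pull]
    rw [← pull_sum]
    exact (pull_id y).symm.trans
      (congrArg (fun t => pull (X := ModuleCat.of A (∀ i, Y i))
        (Y := ModuleCat.of A (∀ i, Y i)) t W n y) (sum_single_comp_proj Y).symm)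
  rw [hid, map_sum]
  refine Finset.sum_eq_zero fun i _ => ?_
  have : LinearMap.proj (φ := fun i => (Y i : Type u)) i ∘ₗ piMap f =
    f i ∘ₗ LinearMap.proj i := rfl
  rw [pull_pull, this]
  erw [← pull_pull (X := ModuleCat.of A (∀ i, X i)) (Y := X i)]
  rw [hf, map_zero]

variable {Λ : Type u} [Finite Λ]

/-- `M` has a filtration of length at most `d` whose successive factors, which have heights
`j, j + 1, …`, are direct sums of modules `Θ_i` and such that the restriction maps on `Ext`
between successive steps vanish. -/
def Good (Θ : Λ → ModuleCat.{u} A) (R : ℕ → Set Λ) : ℕ → ℕ → ModuleCat.{u} A → Prop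
  | 0, _, M => Subsingleton M
  | d + 1, j, M => ∃ (N T : ModuleCat.{u} A) (f : N →ₗ[A] M) (g : M →ₗ[A] T), SES f g ∧
      IsSummand (total Θ) T ∧ Filt Θ (R j) T ∧ (∀ n y, pull f (total Θ) n y = 0) ∧
      Good Θ R d (j + 1) N

variable {Θ : Λ → ModuleCat.{u} A}

namespace Good

theorem of_equiv {R : ℕ → Set Λ} {d j : ℕ} {M M' : ModuleCat.{u} A} (hM : Good Θ R d j M)
    (e : M ≃ₗ[A] M') : Good Θ R d j M' := by
  cases d with
  | zero =>
    have : Subsingleton M := hM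
    exact e.symm.toEquiv.subsingleton
  | succ d =>
    obtain ⟨N, T, f, g, h, hT, hT', hz, hN⟩ := hM
    refine ⟨N, T, e.toLinearMap ∘ₗ f, g ∘ₗ e.symm.toLinearMap,
      ⟨e.injective.comp h.inj, fun y => ?_, h.surj.comp e.symm.surjective⟩, hT, hT',
      fun n y => by rw [← pull_pull, hz], hN⟩
    rw [LinearMap.comp_apply, LinearEquiv.coe_coe, h.exact]
    constructor
    · rintro ⟨x, hx⟩
      exact ⟨x, by simp [hx]⟩
    · rintro ⟨x, hx⟩
      exact ⟨x, by simp [← hx]⟩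

/-- Heights serve only to establish goodness. Dropping them allows sums of modules whose filtrations
start in different heights. -/
theorem forget {R : ℕ → Set Λ} {d j : ℕ} (j' : ℕ) {M : ModuleCat.{u} A} (hM : Good Θ R d j M) :
    Good Θ (fun _ => Set.univ) d j' M := by
  induction d generalizing j j' M with
  | zero => exact hM
  | succ d ih =>
    obtain ⟨N, T, f, g, h, hT, hT', hz, hN⟩ := hM
    exact ⟨N, T, f, g, h, hT, hT'.mono (Set.subset_univ _), hz, ih _ hN⟩

theorem pi {R : ℕ → Set Λ} {d j : ℕ} {ι : Type u} [Finite ι] (M : ι → ModuleCat.{u} A)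
    (hM : ∀ i, Good Θ R d j (M i)) : Good Θ R d j (ModuleCat.of A (∀ i, M i)) := by
  induction d generalizing j M with
  | zero =>
    have : ∀ i, Subsingleton (M i) := hM
    exact inferInstanceAs (Subsingleton (∀ i, M i))
  | succ d ih =>
    choose N T f g h hT hT' hz hN using hM
    exact ⟨_, _, piMap f, piMap g, SES.pi h, IsSummand.pi T hT, Filt.pi T hT',
      fun n y => pull_piMap_eq_zero (fun i y => hz i n y) y, ih N hN⟩

end Good

variable [PartialOrder Λ]

theorem Good.filt {d j : ℕ} {M : ModuleCat.{u} A} (hM : Good Θ (atHt Λ) d j M) :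
    Filt Θ (geHt Λ j) M := by
  induction d generalizing j M with
  | zero => exact .zero _ hM
  | succ d ih =>
    obtain ⟨N, T, f, g, h, -, hT, -, hN⟩ := hM
    exact ((ih hN).mono (geHt_succ_subset j)).extension h (hT.mono (atHt_subset_geHt j))

namespace IsStratified

variable (hΘ : IsStratified Θ)

include hΘ in
-- Goodness says that every class on `X` comes from the top layer `T`, and `X → T` extends to `Y`
-- since Ext¹(Z,T) = 0.
theorem pull_surjective {d j : ℕ} {X Y Z : ModuleCat.{u} A} {f : X →ₗ[A] Y} {g : Y →ₗ[A] Z}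
    (h : SES f g) (hX : Good Θ (atHt Λ) d j X) (hZ : Filt Θ (geHt Λ j) Z) (n : ℕ) :
    Function.Surjective (pull f (total Θ) n) := fun y => by
  cases d with
  | zero =>
    have : Subsingleton X := hX
    exact ⟨0, (ext_subsingleton_of_subsingleton_left n).elim _ _⟩
  | succ d =>
    obtain ⟨N, T, i, p, h', -, hT, hz, -⟩ := hX
    obtain ⟨t, rfl⟩ := h'.exists_pull_of_pull_eq_zero (hz n y)
    obtain ⟨ψ, rfl⟩ := h.extend (hΘ.ext_one hZ hT) p
    exact ⟨pull ψ _ n t, pull_pull _ _ _⟩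

include hΘ in
/-- Cokernels of injective maps of good modules with filtered cokernel are good. -/
theorem good_coker [IsNoetherianRing A] {d j : ℕ} {X Y Z : ModuleCat.{u} A} {f : X →ₗ[A] Y}
    {g : Y →ₗ[A] Z} (h : SES f g) (hX : Good Θ (atHt Λ) d j X) (hY : Good Θ (atHt Λ) d j Y)
    (hZ : Filt Θ (geHt Λ j) Z) : Good Θ (atHt Λ) d j Z := by
  induction d generalizing j X Y Z with
  | zero =>
    have : Subsingleton Y := hY
    exact h.surj.subsingleton
  | succ d ih =>
    obtain ⟨X', TX, iX, pX, hX1, -, hTX, -, hX'⟩ := hX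
    obtain ⟨Y', TY, iY, pY, hY1, -, hTY, hzY, hY'⟩ := hY
    obtain ⟨Z', TZ, iZ, pZ, hZ1, hZ', hTZ⟩ := hΘ.exists_layer hZ
    obtain ⟨f', -, hf', -⟩ := hX1.exists_left hY1 f (hΘ.hom_succ_eq_zero hX'.filt hTY)
    obtain ⟨g', b, hg', hb⟩ := hY1.exists_left hZ1 g (hΘ.hom_succ_eq_zero hY'.filt hTZ)
    have hf1 : ∀ x, iY (f' x) = f (iX x) := LinearMap.congr_fun hf'
    have hg1 : ∀ x, iZ (g' x) = g (iY x) := LinearMap.congr_fun hg'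
    -- The extension of `pX` to `Y` kills `Y'` by heights. So `f x ∈ Y'` forces `x ∈ X'`, which
    -- gives exactness of the submodule sequence in the middle.
    obtain ⟨ψ, hψ⟩ := h.extend (hΘ.ext_one hZ hTX) pX
    have hψ' : ψ ∘ₗ iY = 0 := hΘ.hom_succ_eq_zero hY'.filt hTX _
    have hS : SES f' g' := by
      refine ⟨fun x y hxy => hX1.inj (h.inj ?_), fun y => ⟨fun hy => ?_, ?_⟩,
        hΘ.surjective_left hY1 hZ1 hg' hb h.surj hZ' hTY hTZ⟩
      · rw [← hf1, ← hf1, hxy]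
      · obtain ⟨x, hx⟩ := (h.exact (iY y)).1 (by rw [← hg1, hy, map_zero])
        have hpx : pX x = 0 := by
          rw [← hψ, LinearMap.comp_apply, hx]
          exact LinearMap.congr_fun hψ' y
        obtain ⟨x', rfl⟩ := (hX1.exact x).1 hpx
        exact ⟨x', hY1.inj ((hf1 x').trans hx)⟩
      · rintro ⟨x, rfl⟩
        apply hZ1.inj
        rw [hg1, hf1, h.exact.apply_apply_eq_zero, map_zero]
    refine ⟨Z', TZ, iZ, pZ, hZ1, hΘ.isSummand hTZ, hTZ, fun n z => ?_, ih hS hX' hY' hZ'⟩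
    -- Vanishing may be tested after the injective restriction from `Z'` to `Y'`; there the map
    -- factors through the zero map from Ext of `Y` to Ext of `Y'`.
    refine hS.pull_injective (hΘ.pull_surjective hS hX' hZ') n ?_
    rw [pull_pull, hg', ← pull_pull, hzY, map_zero]

end IsStratified

end Good

/-! ### Relative projectives and the Hom condition. -/

section Covers

variable {A : Type u} [Ring A] {Λ : Type u} [Finite Λ]

/-- The properties of the modules in `add Q` which are used: all higher extensions by the `Θ_i`
vanish, and they embed into a module of `𝓕(Θ)`. -/
structure IsRelProj (Θ : Λ → ModuleCat.{u} A) (P : ModuleCat.{u} A) : Prop where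
  ext : ∀ s : ℕ, 1 ≤ s → Subsingleton (Abelian.Ext P (total Θ) s)
  embed : ∃ (Y : ModuleCat.{u} A) (s : P →ₗ[A] Y), Filt Θ Set.univ Y ∧ Function.Injective s

variable {Θ : Λ → ModuleCat.{u} A}

theorem IsRelProj.ext_filt {P X : ModuleCat.{u} A} (hP : IsRelProj Θ P) {S : Set Λ}
    (hX : Filt Θ S X) : Subsingleton (Abelian.Ext P X 1) :=
  hX.ext_right fun μ _ => (IsSummand.component Θ μ).ext_right (hP.ext 1 le_rfl)

theorem IsRelProj.pi {ι : Type u} [Finite ι] (P : ι → ModuleCat.{u} A)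
    (hP : ∀ i, IsRelProj Θ (P i)) : IsRelProj Θ (ModuleCat.of A (∀ i, P i)) where
  ext s hs := by
    classical
    have := Fintype.ofFinite ι
    exact ext_subsingleton_of_sum_left _ _ (sum_single_comp_proj P) fun i => (hP i).ext s hs
  embed := by
    choose Y s hY hs using fun i => (hP i).embed
    exact ⟨_, piMap s, Filt.pi Y hY, piMap_injective hs⟩

theorem IsRelProj.of_inAdd {Q : Λ → ModuleCat.{u} A} (hQ : ∀ i, Filt Θ Set.univ (Q i))
    (hExt : ∀ s : ℕ, 1 ≤ s → Subsingleton (Abelian.Ext (total Q) (total Θ) s))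
    {P : ModuleCat.{u} A} (hP : InAdd Q P) : IsRelProj Θ P := by
  obtain ⟨n, s, r, hrs⟩ := hP
  have hrs' : ∀ x, r (s x) = x := LinearMap.congr_fun hrs
  refine ⟨fun t ht => ?_, ModuleCat.of A (∀ _ : ULift.{u} (Fin n), total Q),
    LinearMap.pi fun i => LinearMap.proj i.down ∘ₗ s, Filt.pi _ fun _ => Filt.pi Q hQ,
    fun x y hxy => ?_⟩
  · refine ext_subsingleton_of_sum_left (ι := Fin n) (Y := fun _ => total Q)
      (fun i => LinearMap.proj i ∘ₗ s)
      (fun i => r ∘ₗ LinearMap.single A (fun _ : Fin n => (total Q : Type u)) i) ?_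
      (fun _ => hExt t ht)
    ext x
    have h := LinearMap.congr_fun (sum_single_comp_proj fun _ : Fin n => total Q) (s x)
    have h' := congrArg r h
    rw [LinearMap.id_apply, hrs'] at h'
    rw [LinearMap.id_apply]
    refine Eq.trans ?_ h'
    simp only [LinearMap.sum_apply, LinearMap.comp_apply, map_sum]
  · rw [← hrs' x, ← hrs' y]
    exact congrArg r (funext fun i => congrFun hxy ⟨i⟩)

/-- A surjection `p : Q → T` for which `Hom(Q, T) ≅ Hom(T, T)` over `End(T)` induces such an
isomorphism. -/
theorem HomIsoEnd.factor {X T : ModuleCat.{u} A} [IsNoetherian A T] [IsArtinian A T]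
    (h : HomIsoEnd X T) {p : X →ₗ[A] T} (hp : Function.Surjective p) (ψ : X →ₗ[A] T) :
    ∃ χ : T →ₗ[A] T, ψ = χ ∘ₗ p := by
  obtain ⟨e, he⟩ := h
  -- Since `e` is `End(T)`-linear and `p` is onto, `e p` cannot be annihilated from the left by a
  -- nonzero endomorphism.
  have hz : ∀ f : T →ₗ[A] T, f ∘ₗ e p = 0 → f = 0 := fun f hf => by
    rw [← he, EmbeddingLike.map_eq_zero_iff] at hf
    ext x
    obtain ⟨y, rfl⟩ := hp x
    exact LinearMap.congr_fun hf y
  have hzn : ∀ (n : ℕ) (f : T →ₗ[A] T), f ∘ₗ (e p ^ n : Module.End A T) = 0 → f = 0 := by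
    intro n
    induction n with
    | zero => exact fun f hf => hf
    | succ n ih =>
      intro f hf
      refine ih f (hz _ ?_)
      rw [LinearMap.comp_assoc]
      rw [pow_succ] at hf
      exact hf
  -- Fitting decomposition: the projection onto the kernel of a power of `e p` along its range
  -- annihilates that power, hence is zero. So `e p` is injective, and bijective by the artinian
  -- property.
  obtain ⟨n, hn, hn1⟩ := ((LinearMap.eventually_isCompl_ker_pow_range_pow
    (e p : Module.End A T)).and (Filter.eventually_ge_atTop 1)).exists
  have hinj : Function.Injective (e p) := by
    refine (injective_iff_map_eq_zero _).2 fun x hx => ?_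
    have h0 := hzn n (Submodule.projection _ _ hn) (LinearMap.ext fun y =>
      (Submodule.projection_apply_eq_zero_iff hn).2 ⟨y, rfl⟩)
    have hx' : x ∈ LinearMap.ker (e p ^ n : Module.End A T) := by
      obtain ⟨m, rfl⟩ := Nat.exists_eq_add_of_le' hn1
      rw [LinearMap.mem_ker, pow_succ]
      exact (congrArg (e p ^ m : Module.End A T) hx).trans (map_zero (e p ^ m : Module.End A T))
    have h1 := Submodule.projection_apply_left hn ⟨x, hx'⟩
    rw [h0] at h1
    exact h1.symm
  let u := LinearEquiv.ofBijective (e p)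
    ⟨hinj, IsArtinian.surjective_of_injective_endomorphism _ hinj⟩
  -- Indeed `e ψ = (e ψ ∘ u⁻¹) ∘ e p = e ((e ψ ∘ u⁻¹) ∘ p)`.
  refine ⟨e ψ ∘ₗ u.symm.toLinearMap, e.injective ?_⟩
  rw [he, LinearMap.comp_assoc]
  ext x
  change _ = e ψ (u.symm (u x))
  rw [u.symm_apply_apply]

end Covers

/-! ### Relative covers, and goodness of linearly filtered modules. -/

section Linear

variable {A : Type u} [Ring A] {Λ : Type u} [Finite Λ] [PartialOrder Λ]
variable {Θ Q : Λ → ModuleCat.{u} A}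

namespace IsEPSS

variable (h : IsEPSS Θ Q)

omit [Finite Λ] in
include h in
theorem exists_ses (i : Λ) : ∃ (K : ModuleCat.{u} A) (κ : K →ₗ[A] Q i) (π : Q i →ₗ[A] Θ i),
    SES κ π ∧ Filt Θ {j | i < j} K := by
  obtain ⟨f, hf, hk⟩ := h.exact i
  exact ⟨_, _, f, SES.of_surjective hf, Filt.of_hasFiltration hk⟩

omit [Finite Λ] in
include h in
theorem filt (i : Λ) : Filt Θ Set.univ (Q i) := by
  obtain ⟨K, κ, π, hs, hK⟩ := h.exists_ses i
  exact (hK.mono (Set.subset_univ _)).extension hs (Filt.single (Set.mem_univ i))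

include h in
-- Only the Ext¹ condition needs proof. As Ext¹(Q_i,Θ_j) = 0, every class comes from a map `K_i →
-- Θ_j`. The factors `Θ_μ` of `K_i` have `μ > i`, so a nonzero map would give `i < μ ≤ j`.
theorem isStratified (hTop : ∀ i, IsSimpleModule A (TopOf A (Θ i)))
    (hTopNe : ∀ i j, i ≠ j → IsEmpty (TopOf A (Θ i) ≃ₗ[A] TopOf A (Θ j)))
    (hExt : ∀ s : ℕ, 1 ≤ s → Subsingleton (Abelian.Ext (total Q) (total Θ) s)) :
    IsStratified Θ where
  finite := h.finite_Θ
  hom_eq_zero := h.hom_eq_zero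
  top_simple := hTop
  top_ne := hTopNe
  ext_eq_zero i j hij := by
    obtain ⟨K, κ, π, hs, hK⟩ := h.exists_ses i
    refine subsingleton_of_forall_eq 0 fun z => ?_
    have hQ : Subsingleton (Abelian.Ext (Q i) (Θ j) 1) :=
      (IsSummand.component Q i).ext_left ((IsSummand.component Θ j).ext_right (hExt 1 le_rfl))
    obtain ⟨x, rfl⟩ := hs.exists_cls_comp (n := 0) (z := z) (hQ.elim _ _)
    obtain ⟨φ, rfl⟩ := exists_mk₀ x
    rw [hK.hom_eq_zero_left (fun μ hμ ψ => h.hom_eq_zero μ j (fun hμj =>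
      hij (lt_of_lt_of_le hμ hμj)) ψ) φ, mk₀_ofHom_zero]
    exact Abelian.Ext.comp_zero _ _ _ _ _

end IsEPSS

/-- What is used of a relative projective cover `P → T`: it has a kernel `K`, and all maps from `P`
to the modules `Θ_μ` factor through `T`. -/
structure IsCover (Θ : Λ → ModuleCat.{u} A) {K P T : ModuleCat.{u} A} (κ : K →ₗ[A] P)
    (π : P →ₗ[A] T) : Prop where
  ses : SES κ π
  proj : IsRelProj Θ P
  comp_eq_zero : ∀ μ (ψ : P →ₗ[A] Θ μ), ψ ∘ₗ κ = 0

omit [PartialOrder Λ] in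
theorem IsCover.pi {ι : Type u} [Finite ι] {K P T : ι → ModuleCat.{u} A}
    {κ : ∀ i, K i →ₗ[A] P i} {π : ∀ i, P i →ₗ[A] T i} (h : ∀ i, IsCover Θ (κ i) (π i)) :
    IsCover Θ (piMap κ) (piMap π) where
  ses := SES.pi fun i => (h i).ses
  proj := IsRelProj.pi P fun i => (h i).proj
  comp_eq_zero μ ψ := by
    classical
    refine LinearMap.pi_ext fun i x => ?_
    have h1 : piMap κ (Pi.single i x) = (Pi.single i (κ i x) : ∀ i, P i) := by
      funext j
      rw [piMap_apply]
      by_cases hj : j = i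
      · subst hj
        simp
      · simp [Pi.single_eq_of_ne hj]
    have h2 := LinearMap.congr_fun
      ((h i).comp_eq_zero μ (ψ ∘ₗ LinearMap.single A (fun i => (P i : Type u)) i)) x
    exact (congrArg ψ h1).trans h2

omit [PartialOrder Λ] in
-- Degree 0 is the factorization of maps through `T`; in higher degrees Ext of `P` vanishes.
theorem IsCover.pull_eq_zero {K P T : ModuleCat.{u} A} {κ : K →ₗ[A] P} {π : P →ₗ[A] T}
    (h : IsCover Θ κ π) : ∀ n y, pull κ (total Θ) n y = 0
  | 0, y => by
    obtain ⟨ψ, rfl⟩ := exists_mk₀ y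
    rw [pull_mk₀]
    have : ψ ∘ₗ κ = 0 := LinearMap.ext fun x => funext fun μ =>
      LinearMap.congr_fun (h.comp_eq_zero μ (LinearMap.proj μ ∘ₗ ψ)) x
    rw [this, mk₀_ofHom_zero]
  | n + 1, y => by
    rw [(h.proj.ext (n + 1) (by omega)).elim y 0, map_zero]

/-- `M` is generated in height `i` by the sequence `N → M → ⨁ Θ (c x)`. -/
theorem GeneratedInHeight.exists_ses [IsNoetherianRing A] (hΘ : IsStratified Θ) {i : ℕ}
    {M : ModuleCat.{u} A} (h : GeneratedInHeight Θ i M) :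
    ∃ (ι : Type u) (_ : Finite ι) (c : ι → Λ) (N : ModuleCat.{u} A) (n : N →ₗ[A] M)
      (p : M →ₗ[A] ModuleCat.of A (∀ x, Θ (c x))), SES n p ∧ (∀ x, ht (c x) = i) ∧
      Filt Θ (geHt Λ (i + 1)) N ∧ ∀ x, n x ∈ Module.jacobson A M := by
  obtain ⟨hF, m, p, hp, hk, ⟨e⟩⟩ := h
  have hM : Module.Finite A M := (Filt.of_hasFiltration hF).finite hΘ.finite
  let E : layerSum Θ i m ≃ₗ[A] (∀ x : (Σ j : {j : Λ // ht j = i}, Fin (m j)), Θ x.1.1) :=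
    (LinearEquiv.piCurry A (fun (j : {j : Λ // ht j = i}) (_ : Fin (m j)) =>
      (Θ j.1 : Type u))).symm
  have hs : SES (X := ModuleCat.of A (LinearMap.ker p)) (Z := ModuleCat.of A
      (∀ x : (Σ j : {j : Λ // ht j = i}, Fin (m j)), Θ x.1.1))
      (LinearMap.ker p).subtype (E.toLinearMap ∘ₗ p) :=
    ⟨Subtype.val_injective, fun y => by
      rw [LinearMap.comp_apply, LinearEquiv.coe_coe, LinearEquiv.map_eq_zero_iff]
      exact LinearMap.exact_subtype_ker_map p y, E.surjective.comp hp⟩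
  refine ⟨(Σ j : {j : Λ // ht j = i}, Fin (m j)), inferInstance, fun x => x.1.1, _, _, _, hs, fun x => x.1.2,
    Filt.of_hasFiltration hk, fun x => ?_⟩
  let t : TopOf A M →ₗ[A] TopOf A (layerSum Θ i m) :=
    Submodule.mapQ _ _ p (Module.le_comap_jacobson p)
  have ht : Function.Surjective t := fun y => by
    obtain ⟨y, rfl⟩ := Submodule.mkQ_surjective _ y
    obtain ⟨x, rfl⟩ := hp y
    exact ⟨Submodule.Quotient.mk x, rfl⟩
  have hinj := IsNoetherian.injective_of_surjective_endomorphism (e.symm.toLinearMap ∘ₗ t)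
    (e.symm.surjective.comp ht)
  rw [← Submodule.Quotient.mk_eq_zero (Module.jacobson A M)]
  apply hinj
  have h0 : t (Submodule.Quotient.mk x.1) = 0 := by
    change Submodule.Quotient.mk (p x.1) = _
    rw [show p x.1 = 0 from x.2]
    rfl
  change e.symm (t _) = e.symm (t _)
  rw [map_zero]
  exact congrArg e.symm h0

/-- The height of a `Θ_μ` generated in height `i` is `i`. -/
theorem GeneratedInHeight.eq_ht [IsNoetherianRing A] (hΘ : IsStratified Θ) {i : ℕ} {μ : Λ}
    {M : ModuleCat.{u} A} (h : GeneratedInHeight Θ i M) (e : M ≃ₗ[A] Θ μ) : i = ht μ := by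
  obtain ⟨ι, _, c, N, n, p, hs, hc, -, hn⟩ := h.exists_ses hΘ
  -- With no `Θ` on top, `M` would equal its radical and vanish by Nakayama.
  have : Nonempty ι := by
    by_contra hι
    rw [not_nonempty_iff] at hι
    have hM : Module.Finite A M := by
      have := hΘ.finite μ
      exact Module.Finite.equiv e.symm
    have htop : (⊥ : Submodule A M) = ⊤ := eq_top_of_sup_jacobson (top_le_iff.1 fun x _ => by
      obtain ⟨y, rfl⟩ := (hs.exact x).1 (funext fun i => isEmptyElim i)
      exact Submodule.mem_sup_right (hn y))
    have hsub : Subsingleton M := (Submodule.subsingleton_iff A).1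
      (subsingleton_of_bot_eq_top htop)
    have := hΘ.top_simple μ
    have := IsSimpleModule.nontrivial A (TopOf A (Θ μ))
    have h1 : Subsingleton (Θ μ) := e.symm.toEquiv.subsingleton
    exact not_subsingleton (TopOf A (Θ μ)) (Submodule.mkQ_surjective _).subsingleton
  obtain ⟨x⟩ := this
  have hsurj : Function.Surjective
      ((LinearMap.proj (φ := fun x => (Θ (c x) : Type u)) x ∘ₗ p) ∘ₗ e.symm.toLinearMap) :=
    ((Function.surjective_eval (β := fun x => (Θ (c x) : Type u)) x).comp hs.surj).comp e.symm.surjective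
  rw [← hc x, hΘ.eq_of_surjective hsurj]

/-- The sequence of relative syzygies in the definition of linearly filtered modules. -/
structure IsLinearSeq (Θ Q : Λ → ModuleCat.{u} A) (i : ℕ) (Ω : ℕ → ModuleCat.{u} A) : Prop where
  syzygy : ∀ s, IsRelSyzygy Θ Q (Ω s) (Ω (s + 1))
  gen : ∀ s, GeneratedInHeight Θ (i + s) (Ω s)

theorem IsLinearSeq.succ {i : ℕ} {Ω : ℕ → ModuleCat.{u} A} (h : IsLinearSeq Θ Q i Ω) :
    IsLinearSeq Θ Q (i + 1) fun s => Ω (s + 1) where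
  syzygy s := h.syzygy (s + 1)
  gen s := by
    have := h.gen (s + 1)
    rwa [show i + (s + 1) = i + 1 + s by omega] at this

/-- A minimal relative cover of `Θ_μ` is a cover in the above sense. -/
theorem IsEPSS.exists_cover [IsNoetherianRing A] [IsArtinianRing A] (h : IsEPSS Θ Q)
    (hΘ : IsStratified Θ)
    (hExt : ∀ s : ℕ, 1 ≤ s → Subsingleton (Abelian.Ext (total Q) (total Θ) s))
    (hHom : HomIsoEnd (total Q) (total Θ)) {μ : Λ} (hLin : IsLinearlyFiltered Θ Q (Θ μ)) :
    ∃ (K P : ModuleCat.{u} A) (κ : K →ₗ[A] P) (π : P →ₗ[A] Θ μ), IsCover Θ κ π ∧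
      ∃ Ω : ℕ → ModuleCat.{u} A, IsLinearSeq Θ Q (ht μ + 1) Ω ∧ Nonempty (Ω 0 ≃ₗ[A] K) := by
  obtain ⟨i, Ω, ⟨e⟩, hsyz, hgen⟩ := hLin
  have hseq : IsLinearSeq Θ Q i Ω := ⟨hsyz, hgen⟩
  obtain rfl : i = ht μ := (hgen 0).eq_ht hΘ e
  obtain ⟨P, f, hf, ⟨e'⟩⟩ := hsyz 0
  have hP : IsRelProj Θ P := .of_inAdd h.filt hExt hf.inAdd
  have hs : SES (X := ModuleCat.of A (LinearMap.ker f)) (LinearMap.ker f).subtype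
      (e.toLinearMap ∘ₗ f) :=
    ⟨Subtype.val_injective, fun y => by
      rw [LinearMap.comp_apply, LinearEquiv.coe_coe, LinearEquiv.map_eq_zero_iff]
      exact LinearMap.exact_subtype_ker_map f y, e.surjective.comp hf.surjective⟩
  refine ⟨_, P, _, _, ⟨hs, hP, fun ν ψ => ?_⟩, _, hseq.succ, ⟨e'⟩⟩
  -- The minimal cover is compared with `Q μ → Θ μ`: minimality makes `b ∘ a` bijective, so `P` is a
  -- summand of `Q μ` and it suffices to factor `ψ ∘ b` through `π μ`.
  choose K κ π hπ hK using h.exists_ses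
  obtain ⟨a, ha⟩ := (hπ μ).lift (hP.ext_filt (hK μ)) (e.toLinearMap ∘ₗ f)
  have hQ : IsRelProj Θ (Q μ) :=
    ⟨fun s hs => (IsSummand.component Q μ).ext_left (hExt s hs), Q μ, LinearMap.id, h.filt μ,
      Function.injective_id⟩
  obtain ⟨b, hb⟩ := hs.lift (hQ.ext_filt (Filt.of_hasFiltration hf.ker_inF)) (π μ)
  have ha' : ∀ x, π μ (a x) = e (f x) := LinearMap.congr_fun ha
  have hb' : ∀ x, e (f (b x)) = π μ x := LinearMap.congr_fun hb
  have hba := hf.minimal (b ∘ₗ a) (LinearMap.ext fun x => e.injective ((hb' _).trans (ha' _)))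
  have := h.finite_Θ
  have : Module.Finite A (total Θ) := inferInstanceAs (Module.Finite A (∀ i, Θ i))
  classical
  -- The Hom condition concerns the total sums, so `ψ ∘ b` is extended by zero and the factorization
  -- is then read off in the components `μ` and `ν`.
  obtain ⟨Φ, hΦ⟩ := hHom.factor (p := piMap π) (piMap_surjective fun i => (hπ i).surj)
    (LinearMap.single A (fun i => (Θ i : Type u)) ν ∘ₗ (ψ ∘ₗ b) ∘ₗ LinearMap.proj μ)
  let χ : Θ μ →ₗ[A] Θ ν := LinearMap.proj (φ := fun i => (Θ i : Type u)) ν ∘ₗ Φ ∘ₗ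
    LinearMap.single A (fun i => (Θ i : Type u)) μ
  have hχ : ∀ x, ψ (b x) = χ (π μ x) := fun x => by
    have h1 := congrArg (fun t : (∀ i, Θ i) => t ν) (LinearMap.congr_fun hΦ
      (Pi.single μ x : ∀ i, Q i))
    have h2 : piMap π (Pi.single μ x : ∀ i, Q i) = (Pi.single μ (π μ x) : ∀ i, Θ i) := by
      funext j
      rw [piMap_apply]
      by_cases hj : j = μ
      · subst hj
        simp
      · simp [Pi.single_eq_of_ne hj]
    have h3 : (Pi.single ν (ψ (b ((Pi.single μ x : ∀ i, Q i) μ))) : ∀ i, Θ i) ν =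
        (Φ (piMap π (Pi.single μ x : ∀ i, Q i)) : ∀ i, Θ i) ν := h1
    rw [h2, Pi.single_eq_same, Pi.single_eq_same] at h3
    exact h3
  ext x
  obtain ⟨y, hy⟩ := hba.2 x.1
  have h0 : f (b (a y)) = 0 := by
    rw [show b (a y) = x.1 from hy]
    exact x.2
  change ψ x.1 = 0
  rw [← hy]
  change ψ (b (a y)) = 0
  rw [hχ, ← hb', h0, map_zero, map_zero]

omit [PartialOrder Λ] in
/-- The comparison of a minimal relative cover `f` of `M` with a surjection `q` from another
relative projective module all of whose maps to the `Θ_μ` vanish on `ker q`. -/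
theorem IsRelProj.exists_equiv {X P P' M : ModuleCat.{u} A} {x : X →ₗ[A] P}
    {q : P →ₗ[A] M} (hq : SES x q) (hP : IsRelProj Θ P) (hP' : IsRelProj Θ P') {f : P' →ₗ[A] M}
    (hf : Function.Surjective f) (hfk : InF Θ (LinearMap.ker f))
    (hmin : ∀ g : P' →ₗ[A] P', f ∘ₗ g = f → Function.Bijective g)
    (hX : Filt Θ Set.univ X) (h0 : ∀ μ (ψ : P →ₗ[A] Θ μ), ψ ∘ₗ x = 0) :
    Nonempty (X ≃ₗ[A] LinearMap.ker f) := by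
  obtain ⟨r, hr⟩ := (SES.of_surjective hf).lift (hP.ext_filt (Filt.of_hasFiltration hfk)) q
  obtain ⟨t, ht⟩ := hq.lift (hP'.ext_filt hX) f
  have hr' : ∀ y, f (r y) = q y := LinearMap.congr_fun hr
  have ht' : ∀ y, q (t y) = f y := LinearMap.congr_fun ht
  have hbij := hmin (r ∘ₗ t) (LinearMap.ext fun y => (hr' _).trans (ht' _))
  let g := LinearEquiv.ofBijective (r ∘ₗ t) hbij
  have hg : ∀ y, g y = r (t y) := fun _ => rfl
  have hfg : ∀ y, f (g.symm y) = f y := fun y => by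
    conv_rhs => rw [← g.apply_symm_apply y, hg, hr', ht']
  -- `E` is the idempotent of `P` with image `ker r`. It takes values in `ker q`, on which all maps
  -- to the `Θ μ` vanish.
  let E : P →ₗ[A] P := LinearMap.id - t ∘ₗ g.symm.toLinearMap ∘ₗ r
  have hE : ∀ y, E y = y - t (g.symm (r y)) := fun _ => rfl
  have hEE : E ∘ₗ E = E := LinearMap.ext fun y => by
    rw [LinearMap.comp_apply, hE (E y), hE y]
    rw [map_sub r, ← hg, g.apply_symm_apply, sub_self, map_zero, map_zero, sub_zero]
  obtain ⟨E', hE'⟩ := hq.factor_left (φ := E) (LinearMap.ext fun y => by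
    rw [LinearMap.comp_apply, hE, map_sub, ht', hfg, hr', sub_self]; rfl)
  -- `P` is only known to embed in a filtered module, so `E = 0` is tested in `Y`. Then `r` is an
  -- isomorphism over `M`.
  obtain ⟨Y, s, hY, hs⟩ := hP.embed
  have hE0 : E = 0 := by
    have := hY.hom_eq_zero_of_comp E (fun μ _ ψ => by
      rw [← hE', ← LinearMap.comp_assoc, h0, LinearMap.zero_comp]) (s ∘ₗ E) (by
        rw [LinearMap.comp_assoc, hEE])
    exact LinearMap.ext fun y => hs ((LinearMap.congr_fun this y).trans (map_zero s).symm)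
  have hrinj : Function.Injective r := (injective_iff_map_eq_zero r).2 fun y hy => by
    have := hE y
    rw [hE0, hy, map_zero, map_zero, sub_zero] at this
    exact this.symm
  have hrsurj : Function.Surjective r := Function.Surjective.of_comp hbij.2
  refine ⟨SES.equivKer (f := r ∘ₗ x) (g := f) ⟨hrinj.comp hq.inj, fun y => ?_, hf⟩⟩
  obtain ⟨y, rfl⟩ := hrsurj y
  rw [hr', hq.exact y]
  constructor
  · rintro ⟨z, rfl⟩
    exact ⟨z, rfl⟩
  · rintro ⟨z, hz⟩
    exact ⟨z, hrinj hz⟩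

/-- Linearly filtered modules are good. -/
theorem IsLinearSeq.good [IsNoetherianRing A] (hΘ : IsStratified Θ)
    (hQ : ∀ i, Filt Θ Set.univ (Q i))
    (hExt : ∀ s : ℕ, 1 ≤ s → Subsingleton (Abelian.Ext (total Q) (total Θ) s))
    (hcov : ∀ μ, ∃ (K P : ModuleCat.{u} A) (κ : K →ₗ[A] P) (π : P →ₗ[A] Θ μ), IsCover Θ κ π ∧
      ∃ Ω : ℕ → ModuleCat.{u} A, IsLinearSeq Θ Q (ht μ + 1) Ω ∧ Nonempty (Ω 0 ≃ₗ[A] K))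
    (d : ℕ) {i : ℕ} {Ω : ℕ → ModuleCat.{u} A} (h : IsLinearSeq Θ Q i Ω)
    (hd : ∀ x : Λ, ht x < i + d) : Good Θ (atHt Λ) d i (Ω 0) := by
  induction d generalizing i Ω with
  | zero =>
    -- No element has height `i` or more, so both `N` and the top layer are zero.
    obtain ⟨ι, _, c, N, n, p, hs, hc, hN, hn⟩ := (h.gen 0).exists_ses hΘ
    have h1 : Subsingleton N := hN.subsingleton_of_ht_lt fun x => by have := hd x; omega
    have h2 : IsEmpty ι := ⟨fun x => by have := hd (c x); have := hc x; omega⟩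
    refine ⟨fun x y => ?_⟩
    have h3 : ∀ x : Ω 0, x = 0 := fun x => by
      obtain ⟨y, rfl⟩ := (hs.exact x).1 (funext fun i => isEmptyElim i)
      rw [Subsingleton.elim y 0, map_zero]
    rw [h3 x, h3 y]
  | succ d ih =>
    obtain ⟨P', f, hf, ⟨e⟩⟩ := h.syzygy 0
    obtain ⟨ι, _, c, N, n, p, hs, hc, hN, hn⟩ := (h.gen 0).exists_ses hΘ
    have hc' : ∀ x, ht (c x) = i := hc
    have hN' : Filt Θ (geHt Λ (i + 1)) N := hN
    have hfin : Module.Finite A (Ω 0) := (Filt.of_hasFiltration (h.gen 0).1).finite hΘ.finite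
    choose K P κ π hκ Ω' hΩ' e' using hcov
    have hC := IsCover.pi fun x => hκ (c x)
    have hY : Good Θ (atHt Λ) d (i + 1) (ModuleCat.of A (∀ x, K (c x))) := by
      refine Good.pi _ fun x => ?_
      obtain ⟨e''⟩ := e' (c x)
      have := hΩ' (c x)
      rw [hc'] at this
      exact (ih this fun y => by have := hd y; omega).of_equiv e''
    obtain ⟨q, hq⟩ := hs.lift (hC.proj.ext_filt hN') (piMap fun x => π (c x))
    have hq' : ∀ y, p (q y) = piMap (fun x => π (c x)) y := LinearMap.congr_fun hq
    -- The image of `q` covers `M` modulo `N`, and `N` lies in the radical: Nakayama.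
    have hqs : Function.Surjective q := by
      rw [← LinearMap.range_eq_top]
      refine eq_top_of_sup_jacobson (top_le_iff.1 fun x _ => ?_)
      obtain ⟨t, ht⟩ := hC.ses.surj (p x)
      obtain ⟨y, hy⟩ := (hs.exact (x - q t)).1 (by rw [map_sub, hq', ht, sub_self])
      rw [← sub_add_cancel x (q t), ← hy, add_comm]
      exact Submodule.add_mem_sup ⟨t, rfl⟩ (hn y)
    -- Comparing `P → M` with `P → T` gives 0 → ker q → V → N → 0, where `V = ker (P → T)` is the
    -- sum of the syzygies `K (c x)`.
    obtain ⟨V, v, a, b, hv, hab, hva, hnb⟩ := (SES.of_surjective hqs).ker_comp hs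
    rw [hq] at hv
    have hV : Good Θ (atHt Λ) d (i + 1) V :=
      hY.of_equiv (hC.ses.equivKer.trans hv.equivKer.symm)
    have hCV : IsCover Θ v (piMap fun x => π (c x)) := by
      refine ⟨hv, hC.proj, fun μ ψ => LinearMap.ext fun y => ?_⟩
      obtain ⟨z, hz⟩ := (hC.ses.exact (v y)).1 (hv.exact.apply_apply_eq_zero y)
      rw [LinearMap.comp_apply, ← hz]
      exact LinearMap.congr_fun (hC.comp_eq_zero μ ψ) z
    have hX := hΘ.filt_ker d (fun y => by have := hd y; omega) hab hV.filt hN'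
    -- `q` need not be known to be minimal: maps from `P` to the `Θ μ` kill `V ⊇ ker q`, and this
    -- already identifies `ker q` with the syzygy of `M`.
    obtain ⟨e₁⟩ := IsRelProj.exists_equiv (SES.of_surjective hqs) hC.proj
      (.of_inAdd hQ hExt hf.inAdd) hf.surjective hf.ker_inF hf.minimal
      (hX.mono (Set.subset_univ _)) fun μ ψ => by
        rw [← hva, ← LinearMap.comp_assoc, hCV.comp_eq_zero, LinearMap.zero_comp]
    have hX' : Good Θ (atHt Λ) d (i + 1) (ModuleCat.of A (LinearMap.ker q)) :=
      (ih h.succ fun y => by have := hd y; omega).of_equiv (e.trans e₁.symm)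
    have hT : Filt Θ (atHt Λ i) (ModuleCat.of A (∀ x, Θ (c x))) :=
      Filt.pi _ fun x => Filt.single (hc' x)
    refine ⟨N, _, n, p, hs, hΘ.isSummand hT, hT, fun s y => ?_,
      hΘ.good_coker hab hX' hV hN'⟩
    -- Ext of `N` embeds into Ext of `V`, and a class from `M` restricted to `V` passes through `P`,
    -- where it dies.
    refine hab.pull_injective (hΘ.pull_surjective hab hX' hN') s ?_
    rw [pull_pull, hnb, ← pull_pull, hCV.pull_eq_zero, map_zero]

end Linear

/-! ### Modules over the Ext-algebra, shifted gradings and spliced resolutions. -/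

section ExtModules

variable {A : Type u} [Ring A]

/-- The inclusion of `Ext^n(T, T)` into the extension algebra. -/
def gOf (T : ModuleCat.{u} A) (n : ℕ) : ExtFam T T n →+ ExtAlg T :=
  DirectSum.of (ExtFam T T) n

theorem gOf_smul_modOf {M T : ModuleCat.{u} A} {i j : ℕ} (x : ExtFam T T i)
    (y : ExtFam M T j) :
    gOf T i x • modOf M T j y = modOf M T (i + j) (Abelian.Ext.comp y x (add_comm j i)) :=
  DirectSum.Gmodule.of_smul_of (ExtFam T T) (ExtFam M T) x y

theorem gOf_mul_gOf {T : ModuleCat.{u} A} {i j : ℕ} (x : ExtFam T T i) (y : ExtFam T T j) :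
    gOf T i x * gOf T j y = gOf T (i + j) (Abelian.Ext.comp y x (add_comm j i)) :=
  DirectSum.of_mul_of (A := ExtFam T T) x y

theorem ExtAlg.induction {T : ModuleCat.{u} A} {p : ExtAlg T → Prop} (x : ExtAlg T)
    (zero : p 0) (of : ∀ n y, p (gOf T n y)) (add : ∀ x y, p x → p y → p (x + y)) : p x :=
  DirectSum.induction_on x zero of add

theorem ExtMod.induction {M T : ModuleCat.{u} A} {p : ExtMod M T → Prop} (x : ExtMod M T)
    (zero : p 0) (of : ∀ n y, p (modOf M T n y)) (add : ∀ x y, p x → p y → p (x + y)) : p x :=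
  DirectSum.induction_on x zero of add

/-- The homogeneous components. -/
def coeff (M T : ModuleCat.{u} A) (n : ℕ) : ExtMod M T →+ ExtFam M T n :=
  DFinsupp.evalAddMonoidHom n

theorem coeff_modOf_same {M T : ModuleCat.{u} A} (n : ℕ) (y : ExtFam M T n) :
    coeff M T n (modOf M T n y) = y :=
  DirectSum.of_eq_same n y

theorem coeff_modOf_ne {M T : ModuleCat.{u} A} {m n : ℕ} (h : m ≠ n) (y : ExtFam M T m) :
    coeff M T n (modOf M T m y) = 0 :=
  DirectSum.of_eq_of_ne m n y h.symm

theorem ext_coeff {M T : ModuleCat.{u} A} {x y : ExtMod M T}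
    (h : ∀ n, coeff M T n x = coeff M T n y) : x = y :=
  DFinsupp.ext h

theorem mem_of_coeff {M T : ModuleCat.{u} A} (S : AddSubgroup (ExtMod M T)) (x : ExtMod M T)
    (h : ∀ n, modOf M T n (coeff M T n x) ∈ S) : x ∈ S := by
  classical
  have := DirectSum.sum_support_of (β := ExtFam M T) x
  rw [← this]
  exact sum_mem fun n _ => h n

theorem regular_smul {T : ModuleCat.{u} A} (r : ExtAlg T) (x : ExtMod T T) :
    r • x = @HMul.hMul (ExtAlg T) (ExtAlg T) (ExtAlg T) _ r x := by
  induction r using ExtAlg.induction with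
  | zero => exact (zero_smul _ x).trans (zero_mul (M₀ := ExtAlg T) x).symm
  | add r s hr hs =>
    refine (add_smul r s x).trans (Eq.trans ?_ (add_mul r s _).symm)
    rw [hr, hs]
    rfl
  | of i γ =>
    induction x using ExtMod.induction with
    | zero => exact (smul_zero _).trans (mul_zero (M₀ := ExtAlg T) (gOf T i γ)).symm
    | add x y hx hy =>
      refine (smul_add _ x y).trans (Eq.trans ?_ (mul_add (gOf T i γ) _ _).symm)
      rw [hx, hy]
      rfl
    | of j y => exact (gOf_smul_modOf γ y).trans (gOf_mul_gOf γ y).symm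

/-- `Ext^*(T, T)` is the regular module of the extension algebra. -/
def regular (T : ModuleCat.{u} A) : ExtMod T T ≃ₗ[ExtAlg T] ExtAlg T where
  toFun x := x
  invFun x := x
  left_inv _ := rfl
  right_inv _ := rfl
  map_add' _ _ := rfl
  map_smul' r x := regular_smul r x

theorem modOf_comp_congr {X Y T : ModuleCat.{u} A} {a b m n : ℕ} (x : Abelian.Ext X Y a)
    (y : Abelian.Ext Y T b) (hm : a + b = m) (hn : a + b = n) :
    modOf X T m (x.comp y hm) = modOf X T n (x.comp y hn) := by
  subst hm hn
  rfl

/-- Precomposition with an extension, as an additive map. -/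
def precompAdd {X Z : ModuleCat.{u} A} (T : ModuleCat.{u} A) {d : ℕ} (η : Abelian.Ext Z X d)
    (e : ℕ → ℕ) (he : ∀ n, d + n = e n) : ExtMod X T →+ ExtMod Z T :=
  DirectSum.toAddMonoid (β := ExtFam X T) fun n => (modOf Z T (e n)).comp (η.precomp T (he n))

/-- The index function `e` keeps the target degree literally `n` for restrictions and `n + 1` for
connecting maps, which avoids transports between Ext groups. -/
theorem precompAdd_modOf {X Z T : ModuleCat.{u} A} {d : ℕ} {η : Abelian.Ext Z X d} {e : ℕ → ℕ}
    {he : ∀ n, d + n = e n} (n : ℕ) (y : ExtFam X T n) :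
    precompAdd T η e he (modOf X T n y) = modOf Z T (e n) (η.comp y (he n)) :=
  DirectSum.toAddMonoid_of (β := ExtFam X T)
    (fun n => (modOf Z T (e n)).comp (η.precomp T (he n))) n y

theorem precompAdd_smul {X Z T : ModuleCat.{u} A} {d : ℕ} {η : Abelian.Ext Z X d} {e : ℕ → ℕ}
    {he : ∀ n, d + n = e n} (r : ExtAlg T) (x : ExtMod X T) :
    precompAdd T η e he (r • x) = r • precompAdd T η e he x := by
  induction r using ExtAlg.induction with
  | zero => rw [zero_smul, zero_smul, map_zero]
  | add r s hr hs => rw [add_smul, add_smul, map_add, hr, hs]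
  | of i γ =>
    induction x using ExtMod.induction with
    | zero => rw [smul_zero, map_zero, smul_zero]
    | add x y hx hy => rw [smul_add, map_add, map_add, smul_add, hx, hy]
    | of j y =>
      rw [gOf_smul_modOf, precompAdd_modOf, precompAdd_modOf, gOf_smul_modOf,
        ← Abelian.Ext.comp_assoc η y γ (he j) (add_comm j i) (by rw [he, ← he, ← he]; omega)]
      exact modOf_comp_congr _ _ _ _

/-- Precomposition with an extension, as a homomorphism of modules over the extension algebra. -/
def precompLin {X Z : ModuleCat.{u} A} (T : ModuleCat.{u} A) {d : ℕ} (η : Abelian.Ext Z X d)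
    (e : ℕ → ℕ) (he : ∀ n, d + n = e n) : ExtMod X T →ₗ[ExtAlg T] ExtMod Z T where
  toFun := precompAdd T η e he
  map_add' := map_add _
  map_smul' := precompAdd_smul

section

variable {X Z T : ModuleCat.{u} A} {d : ℕ} {η : Abelian.Ext Z X d} {e : ℕ → ℕ}
  {he : ∀ n, d + n = e n}

theorem precompLin_modOf (n : ℕ) (y : ExtFam X T n) :
    precompLin T η e he (modOf X T n y) = modOf Z T (e n) (η.comp y (he n)) :=
  precompAdd_modOf n y

theorem coeff_precompLin (n : ℕ) (x : ExtMod X T) :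
    coeff Z T (e n) (precompLin T η e he x) = η.comp (coeff X T n x) (he n) := by
  induction x using ExtMod.induction with
  | zero => rw [map_zero, map_zero, map_zero, Abelian.Ext.comp_zero]
  | add x y hx hy => rw [map_add, map_add, map_add, hx, hy, Abelian.Ext.comp_add]
  | of m y =>
    rw [precompLin_modOf]
    by_cases h : m = n
    · subst h
      rw [coeff_modOf_same, coeff_modOf_same]
    · rw [coeff_modOf_ne h, Abelian.Ext.comp_zero, coeff_modOf_ne]
      intro h'
      have h1 := he n
      have h2 := he m
      omega

theorem precompLin_injective (h : ∀ n (x : Abelian.Ext X T n), η.comp x (he n) = 0 → x = 0) :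
    Function.Injective (precompLin T η e he) := by
  refine (injective_iff_map_eq_zero _).2 fun x hx => ext_coeff fun n => ?_
  rw [map_zero]
  apply h
  rw [← coeff_precompLin, hx, map_zero]

end

/-- Restriction along a linear map. -/
def pullLin {X Y : ModuleCat.{u} A} (f : X →ₗ[A] Y) (T : ModuleCat.{u} A) :
    ExtMod Y T →ₗ[ExtAlg T] ExtMod X T :=
  precompLin T (Abelian.Ext.mk₀ (ModuleCat.ofHom f)) id (fun n => zero_add n)

theorem pullLin_modOf {X Y T : ModuleCat.{u} A} (f : X →ₗ[A] Y) (n : ℕ) (y : ExtFam Y T n) :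
    pullLin f T (modOf Y T n y) = modOf X T n (pull f T n y) :=
  precompLin_modOf n y

theorem coeff_pullLin {X Y T : ModuleCat.{u} A} (f : X →ₗ[A] Y) (n : ℕ) (x : ExtMod Y T) :
    coeff X T n (pullLin f T x) = pull f T n (coeff Y T n x) :=
  coeff_precompLin (e := id) n x

theorem pullLin_surjective {X Y T : ModuleCat.{u} A} {f : X →ₗ[A] Y}
    (h : ∀ n, Function.Surjective (pull f T n)) : Function.Surjective (pullLin f T) := fun x => by
  induction x using ExtMod.induction with
  | zero => exact ⟨0, map_zero _⟩
  | add x y hx hy =>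
    obtain ⟨a, rfl⟩ := hx
    obtain ⟨b, rfl⟩ := hy
    exact ⟨a + b, map_add _ _ _⟩
  | of n y =>
    obtain ⟨z, rfl⟩ := h n y
    exact ⟨modOf Y T n z, pullLin_modOf f n z⟩

/-- The connecting homomorphism of a short exact sequence. -/
def SES.delta {X Y Z : ModuleCat.{u} A} {f : X →ₗ[A] Y} {g : Y →ₗ[A] Z} (h : SES f g)
    (T : ModuleCat.{u} A) : ExtMod X T →ₗ[ExtAlg T] ExtMod Z T :=
  precompLin T h.cls (fun n => n + 1) (add_comm 1)

theorem SES.delta_modOf {X Y Z T : ModuleCat.{u} A} {f : X →ₗ[A] Y} {g : Y →ₗ[A] Z}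
    (h : SES f g) (n : ℕ) (y : ExtFam X T n) :
    h.delta T (modOf X T n y) = modOf Z T (n + 1) (h.cls.comp y (add_comm 1 n)) :=
  precompLin_modOf n y

theorem SES.delta_injective {X Y Z T : ModuleCat.{u} A} {f : X →ₗ[A] Y} {g : Y →ₗ[A] Z}
    (h : SES f g) (h0 : ∀ n y, pull f T n y = 0) : Function.Injective (h.delta T) :=
  precompLin_injective fun n x hx => by
    obtain ⟨y, rfl⟩ := h.exists_pull_of_cls_comp hx
    exact h0 n y

theorem SES.exact_delta {X Y Z T : ModuleCat.{u} A} {f : X →ₗ[A] Y} {g : Y →ₗ[A] Z}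
    (h : SES f g) : Function.Exact (h.delta T) (pullLin g T) := fun z => by
  constructor
  · intro hz
    refine mem_of_coeff (LinearMap.range (h.delta T)).toAddSubgroup z fun n => ?_
    have hn : pull g T n (coeff Z T n z) = 0 := by rw [← coeff_pullLin, hz, map_zero]
    cases n with
    | zero =>
      -- In degree 0 nothing comes from the connecting map, and restriction along a surjection is
      -- injective.
      rw [pull_zero_injective h.surj T (hn.trans (map_zero _).symm), map_zero]
      exact zero_mem _
    | succ n =>
      obtain ⟨x, hx⟩ := h.exists_cls_comp hn
      exact ⟨modOf X T n x, by rw [h.delta_modOf, hx]⟩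
  · rintro ⟨x, rfl⟩
    induction x using ExtMod.induction with
    | zero => rw [map_zero, map_zero]
    | add x y hx hy => rw [map_add, map_add, hx, hy, add_zero]
    | of n y => rw [h.delta_modOf, pullLin_modOf, h.pull_cls_comp, map_zero]

/-- A criterion for internal direct sums in terms of projections. -/
theorem isInternal_of_projections {G S : Type*} [AddCommGroup G] [SetLike S G]
    [AddSubgroupClass S G] (𝒬 : ℕ → S) (π : ℕ → G →+ G) (h1 : ∀ n, ∀ x ∈ 𝒬 n, π n x = x)
    (h2 : ∀ m n, m ≠ n → ∀ x ∈ 𝒬 m, π n x = 0)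
    (h3 : ∀ H : AddSubgroup G, (∀ n, ∀ x ∈ 𝒬 n, x ∈ H) → H = ⊤) : DirectSum.IsInternal 𝒬 := by
  classical
  constructor
  · refine (injective_iff_map_eq_zero _).2 fun x hx => ?_
    have key : ∀ (n : ℕ) (y : ⨁ n, 𝒬 n), π n (DirectSum.coeAddMonoidHom 𝒬 y) = y n := by
      intro n y
      induction y using DirectSum.induction_on with
      | zero => simp
      | add x y hx hy => simp [hx, hy]
      | of m y =>
        rw [DirectSum.coeAddMonoidHom_of]
        by_cases h : m = n
        · subst h
          rw [DirectSum.of_eq_same, h1 m _ y.2]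
        · rw [DirectSum.of_eq_of_ne _ _ _ (Ne.symm h), h2 m n h _ y.2]
          rfl
    refine DFinsupp.ext fun n => Subtype.ext ?_
    have := key n x
    rw [hx, map_zero] at this
    exact this.symm
  · rw [← AddMonoidHom.range_eq_top]
    exact h3 _ fun n x hx => ⟨DirectSum.of (fun n => 𝒬 n) n ⟨x, hx⟩,
      DirectSum.coeAddMonoidHom_of _ _ _⟩

/-- The grading of `Ext^*(M, T)` shifted by `s`. -/
def shiftGrading (M T : ModuleCat.{u} A) (s n : ℕ) : AddSubgroup (ExtMod M T) where
  carrier := {x | ∀ m, m + s ≠ n → coeff M T m x = 0}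
  zero_mem' _ _ := map_zero _
  add_mem' hx hy m hm := by rw [map_add, hx m hm, hy m hm, add_zero]
  neg_mem' hx m hm := by rw [map_neg, hx m hm, neg_zero]

theorem modOf_mem_shiftGrading {M T : ModuleCat.{u} A} {s m n : ℕ} (h : m + s = n)
    (y : ExtFam M T m) : modOf M T m y ∈ shiftGrading M T s n :=
  fun l hl => coeff_modOf_ne (by omega) y

theorem mem_shiftGrading {M T : ModuleCat.{u} A} {s n : ℕ} {x : ExtMod M T}
    (hx : x ∈ shiftGrading M T s n) :
    x = 0 ∨ ∃ (m : ℕ) (y : ExtFam M T m), m + s = n ∧ x = modOf M T m y := by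
  by_cases h : s ≤ n
  · refine .inr ⟨n - s, coeff M T (n - s) x, by omega, ext_coeff fun l => ?_⟩
    by_cases hl : n - s = l
    · subst hl
      rw [coeff_modOf_same]
    · rw [coeff_modOf_ne hl, hx l (by omega)]
  · refine .inl (ext_coeff fun l => ?_)
    rw [hx l (by omega), map_zero]

theorem extModGrading_eq (M T : ModuleCat.{u} A) : extModGrading M T = shiftGrading M T 0 := by
  funext n
  ext x
  constructor
  · rintro ⟨y, rfl⟩
    exact modOf_mem_shiftGrading (add_zero n) y
  · intro hx
    rcases mem_shiftGrading hx with rfl | ⟨m, y, rfl, rfl⟩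
    · exact zero_mem _
    · exact ⟨y, rfl⟩

variable {k : Type u} [Field k] [Algebra k A]

theorem isGradedModule_shiftGrading (M T : ModuleCat.{u} A) (s : ℕ) :
    IsGradedModule (extAlgGrading k T) (shiftGrading M T s) where
  internal := by
    refine isInternal_of_projections _ (fun n => if s ≤ n then
      (modOf M T (n - s)).comp (coeff M T (n - s)) else 0) (fun n x hx => ?_)
      (fun m n hmn x hx => ?_) fun H hH => ?_
    · rcases mem_shiftGrading hx with rfl | ⟨m, y, rfl, rfl⟩
      · exact map_zero _
      · rw [if_pos (by omega), Nat.add_sub_cancel]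
        exact congrArg (modOf M T m) (coeff_modOf_same m y)
    · rcases mem_shiftGrading hx with rfl | ⟨m, y, rfl, rfl⟩
      · exact map_zero _
      · split_ifs with h
        · exact (congrArg (modOf M T (n - s)) (coeff_modOf_ne (by omega) y)).trans (map_zero _)
        · rfl
    · exact top_le_iff.1 fun x _ => mem_of_coeff H x fun n =>
        hH (n + s) _ (modOf_mem_shiftGrading rfl _)
  smul_mem i j a x ha hx := by
    obtain ⟨γ, rfl⟩ := ha
    rcases mem_shiftGrading hx with rfl | ⟨m, y, rfl, rfl⟩
    · rw [smul_zero]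
      exact zero_mem _
    · rw [algOf_smul_modOf]
      exact modOf_mem_shiftGrading (by omega) _

/-- `Ext^*(X, T)` is generated in degree zero. -/
def ExtGenerated (X T : ModuleCat.{u} A) : Prop :=
  ∀ (n : ℕ) (y : Abelian.Ext X T n),
    y ∈ AddSubgroup.closure {z | ∃ (α : X →ₗ[A] T) (γ : Abelian.Ext T T n), z = pull α T n γ}

/-- Splitting the identity of `X` through copies of `T` writes `y` as a sum of classes on `T` pulled
back along the maps `α i`. -/
theorem IsSummand.extGenerated {X T : ModuleCat.{u} A} (h : IsSummand T X) :
    ExtGenerated X T := fun n y => by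
  obtain ⟨ι, _, α, β, hab⟩ := h
  rw [← pull_id y, ← hab, pull_sum]
  refine sum_mem fun i _ => AddSubgroup.subset_closure ⟨α i, pull (β i) T n y, ?_⟩
  rw [pull_pull]

theorem ExtGenerated.of_pull {X Y T : ModuleCat.{u} A} {g : X →ₗ[A] Y} (h : ExtGenerated Y T)
    (hg : ∀ n, Function.Surjective (pull g T n)) : ExtGenerated X T := fun n x => by
  obtain ⟨y, rfl⟩ := hg n x
  have := AddSubgroup.mem_map_of_mem (pull g T n) (h n y)
  rw [AddMonoidHom.map_closure] at this
  refine AddSubgroup.closure_mono ?_ this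
  rintro _ ⟨_, ⟨α, γ, rfl⟩, rfl⟩
  exact ⟨α ∘ₗ g, γ, pull_pull _ _ _⟩

theorem ExtGenerated.generatedInDegree {X T : ModuleCat.{u} A} (h : ExtGenerated X T) (s : ℕ) :
    GeneratedInDegree (ExtAlg T) (shiftGrading X T s) s := by
  let S : Submodule (ExtAlg T) (ExtMod X T) :=
    Submodule.span (ExtAlg T) (shiftGrading X T s s : Set (ExtMod X T))
  have h1 : ∀ n (α : X →ₗ[A] T) (γ : Abelian.Ext T T n), modOf X T n (pull α T n γ) ∈ S := by
    intro n α γ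
    have h2 : gOf T n γ • modOf X T 0 (Abelian.Ext.mk₀ (ModuleCat.ofHom α)) =
      modOf X T n (pull α T n γ) := gOf_smul_modOf γ _
    rw [← h2]
    exact S.smul_mem _ (Submodule.subset_span (modOf_mem_shiftGrading (zero_add s) _))
  have h3 : ∀ n (y : Abelian.Ext X T n), modOf X T n y ∈ S := fun n y =>
    AddSubgroup.closure_induction (p := fun y _ => modOf X T n y ∈ S)
      (by rintro _ ⟨α, γ, rfl⟩; exact h1 n α γ) (by rw [map_zero]; exact S.zero_mem)
      (fun x y _ _ hx hy => by rw [map_add]; exact S.add_mem hx hy)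
      (fun x _ hx => by rw [map_neg]; exact S.neg_mem hx) (h n y)
  change S = ⊤
  exact eq_top_iff.2 fun x _ => mem_of_coeff S.toAddSubgroup x fun n => h3 n _

/-- Applying Ext^*(-,T) to a splitting of `X` off copies of `T` splits the module off a free module.
-/
theorem IsSummand.projective {X T : ModuleCat.{u} A} (h : IsSummand T X) :
    Module.Projective (ExtAlg T) (ExtMod X T) := by
  obtain ⟨ι, _, α, β, hab⟩ := h
  refine Module.Projective.of_split (M := ι → ExtAlg T)
    (LinearMap.pi fun i => (regular T).toLinearMap ∘ₗ pullLin (β i) T)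
    (∑ i, (pullLin (α i) T ∘ₗ (regular T).symm.toLinearMap) ∘ₗ LinearMap.proj i) ?_
  refine LinearMap.ext fun x => ?_
  simp only [LinearMap.comp_apply, LinearMap.sum_apply, LinearMap.proj_apply, LinearMap.pi_apply,
    LinearEquiv.coe_coe, LinearEquiv.symm_apply_apply, LinearMap.id_apply]
  induction x using ExtMod.induction with
  | zero => simp
  | add x y hx hy => simp only [map_add, Finset.sum_add_distrib, hx, hy]
  | of n y =>
    simp only [pullLin_modOf, pull_pull]
    rw [← map_sum, ← pull_sum, hab, pull_id]

/-- A property of modules `M` which provides filtrations with subquotients in `add T` and vanishing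
restriction maps yields linear resolutions of `Ext^*(M, T)`. -/
theorem hasLinearResolution_of_filtrations {T : ModuleCat.{u} A} {R : ModuleCat.{u} A → Prop}
    (hR : ∀ M, R M → ∃ (N X : ModuleCat.{u} A) (f : N →ₗ[A] M) (g : M →ₗ[A] X), SES f g ∧
      IsSummand T X ∧ (∀ n y, pull f T n y = 0) ∧ R N) {M : ModuleCat.{u} A} (hM : R M) :
    HasLinearResolution (extAlgGrading k T) (extModGrading M T) := by
  choose! N X f g hs hX h0 hN using hR
  let F : ℕ → {M : ModuleCat.{u} A // R M} :=
    fun n => Nat.rec ⟨M, hM⟩ (fun _ Y => ⟨N Y.1, hN Y.1 Y.2⟩) n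
  have hS : ∀ n, SES (X := (F (n + 1)).1) (f (F n).1) (g (F n).1) := fun n => hs _ (F n).2
  have hsurj : ∀ n, Function.Surjective (pullLin (g (F n).1) T) := fun n =>
    pullLin_surjective fun m y => (hS n).exists_pull_of_pull_eq_zero (h0 _ (F n).2 m y)
  have hinj : ∀ n, Function.Injective ((hS n).delta T) := fun n =>
    (hS n).delta_injective (h0 _ (F n).2)
  -- The shift by `n` places the generators of the `n`-th term in degree `n` and makes the
  -- connecting maps homogeneous of degree 0.
  refine ⟨fun n => ModuleCat.of (ExtAlg T) (ExtMod (X (F n).1) T),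
    fun n => shiftGrading (X (F n).1) T n,
    fun n => (hS n).delta T ∘ₗ pullLin (g (F (n + 1)).1) T, pullLin (g M) T,
    fun n => isGradedModule_shiftGrading _ _ n, fun n => (hX _ (F n).2).projective,
    fun n => (hX _ (F n).2).extGenerated.generatedInDegree n, fun n i x hx => ?_,
    fun i x hx => ?_, fun n x => ?_, fun x => ?_, hsurj 0⟩
  · rcases mem_shiftGrading hx with rfl | ⟨m, y, rfl, rfl⟩
    · rw [map_zero]
      exact zero_mem _
    · rw [LinearMap.comp_apply, pullLin_modOf, SES.delta_modOf]
      exact modOf_mem_shiftGrading (by omega) _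
  · rw [extModGrading_eq]
    rcases mem_shiftGrading hx with rfl | ⟨m, y, rfl, rfl⟩
    · rw [map_zero]
      exact zero_mem _
    · have h1 : pullLin (g M) T (modOf (X M) T m y) = modOf M T m (pull (g M) T m y) :=
        pullLin_modOf _ m y
      exact h1 ▸ modOf_mem_shiftGrading rfl _
  -- Each differential is a surjection followed by an injection, so its kernel and image are those
  -- of the short exact pieces.
  · have h1 := (hS (n + 1)).exact_delta (T := T) x
    rw [LinearMap.comp_apply, (injective_iff_map_eq_zero' _).1 (hinj n), h1]
    constructor
    · rintro ⟨z, rfl⟩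
      obtain ⟨w, rfl⟩ := hsurj (n + 2) z
      exact ⟨w, rfl⟩
    · rintro ⟨w, rfl⟩
      exact ⟨_, rfl⟩
  · have h1 := (hS 0).exact_delta (T := T) x
    refine h1.trans ?_
    constructor
    · rintro ⟨z, rfl⟩
      obtain ⟨w, rfl⟩ := hsurj 1 z
      exact ⟨w, rfl⟩
    · rintro ⟨w, rfl⟩
      exact ⟨_, rfl⟩

end ExtModules

/-! ### Finite dimensionality of Ext. -/

section Finiteness

variable {k : Type u} [Field k] {A : Type u} [Ring A] [Algebra k A] [FiniteDimensional k A]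

open scoped ModuleCat in
-- Dimension shifting along a finite free cover: the connecting map from Ext^n of the kernel is onto
-- Ext^{n+1}.
theorem ext_finite (n : ℕ) (M N : ModuleCat.{u} A) [Module.Finite A M] [Module.Finite A N] :
    Module.Finite k (Abelian.Ext M N n) := by
  induction n generalizing M with
  | zero =>
    have hM : Module.Finite k M := Module.Finite.trans A M
    have hN : Module.Finite k N := Module.Finite.trans A N
    let φ : (M ⟶ N) →ₗ[k] (M →ₗ[k] N) :=
      { toFun := fun f => f.hom.restrictScalars k
        map_add' := fun f g => rfl
        map_smul' := fun r f => LinearMap.ext fun x => rfl }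
    have hφ : Function.Injective φ := fun f g hfg =>
      ModuleCat.hom_ext (LinearMap.ext fun x => LinearMap.congr_fun hfg x)
    have : Module.Finite k (M ⟶ N) := Module.Finite.of_injective φ hφ
    exact Module.Finite.equiv (Abelian.Ext.linearEquiv₀ (R := k) (X := M) (Y := N)).symm
  | succ n ih =>
    obtain ⟨m, p, hp⟩ := Module.Finite.exists_fin' A M
    have : IsNoetherianRing A := isNoetherian_of_tower k inferInstance
    have hs := SES.of_surjective (Y := ModuleCat.of A (Fin m → A)) hp
    have hproj : Projective (ModuleCat.of A (Fin m → A)) :=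
      (IsProjective.iff_projective (R := A) (Fin m → A)).1 inferInstance
    have hfin := ih (ModuleCat.of A (LinearMap.ker p))
    refine Module.Finite.of_surjective
      (Abelian.Ext.precompOfLinear hs.cls k N (add_comm 1 n)) fun z => ?_
    exact hs.exists_cls_comp ((Abelian.Ext.subsingleton_of_projective _ N n).elim _ _)

end Finiteness

/-! ### The grading of the Ext-algebra and its degree-zero module. -/

section Algebra

variable {k : Type u} [Field k] {A : Type u} [Ring A] [Algebra k A]

theorem isInternal_extAlgGrading (T : ModuleCat.{u} A) :
    DirectSum.IsInternal (extAlgGrading k T) := by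
  refine isInternal_of_projections _ (fun n => ((regular T).toAddEquiv.toAddMonoidHom.comp
    ((modOf T T n).comp (coeff T T n))).comp (regular T).symm.toAddEquiv.toAddMonoidHom)
    (fun n x hx => ?_) (fun m n hmn x hx => ?_) fun H hH => ?_
  · obtain ⟨y, rfl⟩ := hx
    exact congrArg (fun t => regular T (modOf T T n t)) (coeff_modOf_same n y)
  · obtain ⟨y, rfl⟩ := hx
    refine (congrArg (fun t => regular T (modOf T T n t)) (coeff_modOf_ne hmn y)).trans ?_
    change regular T (modOf T T n 0) = 0
    rw [map_zero, map_zero]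
  · refine top_le_iff.1 fun x _ => ?_
    induction x using ExtAlg.induction with
    | zero => exact zero_mem _
    | add x y hx hy => exact add_mem (hx trivial) (hy trivial)
    | of n y => exact hH n _ ⟨y, rfl⟩

theorem extAlgGrading_mul_le (T : ModuleCat.{u} A) (i j : ℕ) :
    extAlgGrading k T i * extAlgGrading k T j ≤ extAlgGrading k T (i + j) := by
  rw [Submodule.mul_le]
  rintro _ ⟨x, rfl⟩ _ ⟨y, rfl⟩
  rw [algOf_mul_algOf]
  exact ⟨_, rfl⟩

theorem one_mem_extAlgGrading (T : ModuleCat.{u} A) : (1 : ExtAlg T) ∈ extAlgGrading k T 0 :=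
  ⟨Abelian.Ext.mk₀ (𝟙 T), rfl⟩

/-- If `P → T` is surjective with kernel `K`, `Ext^*(K, T)` is generated in degree `0`, and
the higher extensions of `P` by `T` vanish, then `Ext^*(T, T)` is generated in degrees `0`, `1`. -/
theorem extAlgGrading_mul_eq {T K P : ModuleCat.{u} A} {κ : K →ₗ[A] P} {π : P →ₗ[A] T}
    (h : SES κ π) (hP : ∀ s : ℕ, 1 ≤ s → Subsingleton (Abelian.Ext P T s))
    (hK : ExtGenerated K T) (i j : ℕ) :
    extAlgGrading k T i * extAlgGrading k T j = extAlgGrading k T (i + j) := by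
  have h1 : ∀ n, extAlgGrading k T (n + 1) ≤ extAlgGrading k T n * extAlgGrading k T 1 := by
    rintro n _ ⟨z, rfl⟩
    -- Since Ext^{n+1}(P,T) = 0, `z` is the class of the sequence followed by some `y` in
    -- Ext^n(K,T), and `y` may be taken of the form `pull α T n γ`.
    obtain ⟨y, rfl⟩ := h.exists_cls_comp (z := z) ((hP (n + 1) (by omega)).elim _ _)
    refine AddSubgroup.closure_induction (p := fun y _ => algOf k T (n + 1)
      (h.cls.comp y (add_comm 1 n)) ∈ extAlgGrading k T n * extAlgGrading k T 1)
      ?_ ?_ ?_ ?_ (hK n y)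
    · rintro _ ⟨α, γ, rfl⟩
      -- Associativity regroups `γ ∘ α ∘ cls` as `γ` in degree `n` times `α ∘ cls` in degree 1.
      have h2 : algOf k T n γ * algOf k T 1
          (h.cls.comp (Abelian.Ext.mk₀ (ModuleCat.ofHom α)) (add_zero 1)) =
          algOf k T (n + 1) (h.cls.comp (pull α T n γ) (add_comm 1 n)) := by
        rw [algOf_mul_algOf, Abelian.Ext.comp_assoc_of_second_deg_zero]
        rfl
      rw [← h2]
      exact Submodule.mul_mem_mul ⟨γ, rfl⟩ ⟨_, rfl⟩
    · rw [Abelian.Ext.comp_zero, map_zero]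
      exact zero_mem _
    · intro x y _ _ hx hy
      rw [Abelian.Ext.comp_add, map_add]
      exact add_mem hx hy
    · intro x _ hx
      rw [Abelian.Ext.comp_neg, map_neg]
      exact neg_mem hx
  refine le_antisymm (extAlgGrading_mul_le T i j) ?_
  induction j with
  | zero =>
    intro x hx
    rw [← mul_one x]
    exact Submodule.mul_mem_mul hx (one_mem_extAlgGrading T)
  | succ j ih =>
    calc extAlgGrading k T (i + j + 1)
        ≤ extAlgGrading k T (i + j) * extAlgGrading k T 1 := h1 _
      _ ≤ extAlgGrading k T i * extAlgGrading k T j * extAlgGrading k T 1 :=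
          mul_le_mul' ih le_rfl
      _ = extAlgGrading k T i * (extAlgGrading k T j * extAlgGrading k T 1) := mul_assoc _ _ _
      _ ≤ extAlgGrading k T i * extAlgGrading k T (j + 1) :=
          mul_le_mul' le_rfl (extAlgGrading_mul_le T j 1)

theorem HasLinearResolution.of_equiv {R : Type u} [Ring R] [Algebra k R] {M N : Type u}
    [AddCommGroup M] [Module R M] [AddCommGroup N] [Module R N] {𝒜 : ℕ → Submodule k R}
    {ℳ : ℕ → AddSubgroup M} {𝒩 : ℕ → AddSubgroup N} (h : HasLinearResolution 𝒜 ℳ)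
    (e : M ≃ₗ[R] N) (he : IsGradedHom ℳ 𝒩 e.toLinearMap) : HasLinearResolution 𝒜 𝒩 := by
  obtain ⟨P, 𝒬, d, ε, h1, h2, h3, h4, h5, h6, h7, h8⟩ := h
  refine ⟨P, 𝒬, d, e.toLinearMap ∘ₗ ε, h1, h2, h3, h4, fun i m hm => he i _ (h5 i m hm), h6,
    fun x => ?_, e.surjective.comp h8⟩
  rw [LinearMap.comp_apply, LinearEquiv.coe_coe, LinearEquiv.map_eq_zero_iff]
  exact h7 x

section Quotient

variable {T P : ModuleCat.{u} A} {π : P →ₗ[A] T}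

theorem modOf_eq_zero (hP : ∀ s : ℕ, 1 ≤ s → Subsingleton (Abelian.Ext P T s)) {n : ℕ}
    (hn : 1 ≤ n) (y : ExtFam P T n) : modOf P T n y = 0 := by
  rw [(hP n hn).elim y 0, map_zero]

/-- Restriction along `π` is injective in degree 0 because `π` is onto, and zero in positive degrees
because Ext^s(P,T) = 0. -/
theorem ker_pullLin (hπ : Function.Surjective π)
    (hP : ∀ s : ℕ, 1 ≤ s → Subsingleton (Abelian.Ext P T s)) :
    LinearMap.ker (pullLin π T ∘ₗ (regular T).symm.toLinearMap) =
      posIdeal (extAlgGrading k T) := by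
  apply le_antisymm
  · intro x hx
    have hx' : pullLin π T ((regular T).symm x) = 0 := hx
    obtain ⟨x, rfl⟩ := (regular T).surjective x
    rw [LinearEquiv.symm_apply_apply] at hx'
    refine mem_of_coeff ((posIdeal (extAlgGrading k T)).comap
      (regular T).toLinearMap).toAddSubgroup x fun n => ?_
    change regular T (modOf T T n (coeff T T n x)) ∈ posIdeal (extAlgGrading k T)
    cases n with
    | zero =>
      have h0 : pull π T 0 (coeff T T 0 x) = 0 := by rw [← coeff_pullLin, hx', map_zero]
      rw [pull_zero_injective hπ T (h0.trans (map_zero _).symm), map_zero, map_zero]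
      exact zero_mem _
    | succ n => exact Submodule.subset_span (Set.mem_iUnion.2 ⟨n, coeff T T (n + 1) x, rfl⟩)
  · refine Submodule.span_le.2 fun x hx => ?_
    obtain ⟨n, y, rfl⟩ := Set.mem_iUnion.1 hx
    exact (pullLin_modOf π (n + 1) y).trans (modOf_eq_zero hP (by omega) _)

/-- If `P → T` induces `Ext^*(P, T) = Γ₀` and `Ext^*(P, T)` has a linear resolution, then `Γ₀` is a
Koszul module. -/
theorem isKoszulModule_degZero (hπ : Function.Surjective π)
    (hP : ∀ s : ℕ, 1 ≤ s → Subsingleton (Abelian.Ext P T s))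
    (hsurj : ∀ n, Function.Surjective (pull π T n))
    (hL : HasLinearResolution (extAlgGrading k T) (extModGrading P T)) :
    IsKoszulModule (extAlgGrading k T) (degZeroGrading (extAlgGrading k T)) := by
  let e : (ExtAlg T ⧸ posIdeal (extAlgGrading k T)) ≃ₗ[ExtAlg T] ExtMod P T :=
    (Submodule.quotEquivOfEq _ _ (ker_pullLin hπ hP).symm).trans
      (LinearMap.quotKerEquivOfSurjective _
        ((pullLin_surjective hsurj).comp (regular T).symm.surjective))
  refine ⟨⟨?_, fun i j a m ha hm => ?_⟩, ?_, hL.of_equiv e.symm fun i m hm => ?_⟩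
  · refine isInternal_of_projections _ (fun n => if n = 0 then AddMonoidHom.id _ else 0)
      (fun n x hx => ?_) (fun m n hmn x hx => ?_) fun H hH => ?_
    · unfold degZeroGrading at hx
      split_ifs at hx ⊢ with hn
      · rfl
      · exact ((AddSubgroup.mem_bot).1 hx).symm
    · unfold degZeroGrading at hx
      split_ifs at hx ⊢ with hn hm hm
      · omega
      · exact (AddSubgroup.mem_bot).1 hx
      · rfl
      · rfl
    · exact top_le_iff.1 fun x _ => hH 0 x (by simp [degZeroGrading])
  · by_cases hi : i = 0
    · subst hi
      rw [zero_add]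
      unfold degZeroGrading at hm ⊢
      split_ifs at hm ⊢
      · trivial
      · rw [(AddSubgroup.mem_bot).1 hm, smul_zero]
        exact zero_mem _
    · obtain ⟨γ, rfl⟩ := ha
      -- Ext^*(P,T) is concentrated in degree 0, so elements of positive degree annihilate it; this
      -- transfers along `e`.
      have h0 : ∀ x : ExtMod P T, algOf k T i γ • x = 0 := fun x => by
        induction x using ExtMod.induction with
        | zero => rw [smul_zero]
        | add x y hx hy => rw [smul_add, hx, hy, add_zero]
        | of n y => rw [algOf_smul_modOf, modOf_eq_zero hP (by omega)]
      have h1 : algOf k T i γ • m = 0 := e.injective (by rw [map_smul, h0, map_zero])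
      rw [h1]
      exact zero_mem _
  · unfold GeneratedInDegree degZeroGrading
    simp
  · obtain ⟨y, rfl⟩ := hm
    by_cases hi : i = 0
    · simp [degZeroGrading, hi]
    · rw [modOf_eq_zero hP (by omega), map_zero]
      exact zero_mem _

end Quotient

end Algebra

/-! ### Koszul modules from good filtrations. -/

section Good

variable {k : Type u} [Field k] {A : Type u} [Ring A] [Algebra k A] {Λ : Type u} [Finite Λ]
variable {Θ : Λ → ModuleCat.{u} A} {R : ℕ → Set Λ} {d j : ℕ} {M : ModuleCat.{u} A}

theorem Good.exists_ses (h : Good Θ R d j M) :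
    ∃ (N X : ModuleCat.{u} A) (f : N →ₗ[A] M) (g : M →ₗ[A] X), SES f g ∧
      IsSummand (total Θ) X ∧ (∀ n y, pull f (total Θ) n y = 0) ∧
      ∃ d j, Good Θ R d j N := by
  cases d with
  | zero =>
    -- The zero module serves as its own next step, so the iteration never stops and the resolution
    -- continues by zero terms.
    have hM : Subsingleton M := h
    exact ⟨M, M, LinearMap.id, LinearMap.id, ⟨Function.injective_id, fun y =>
      ⟨fun _ => ⟨y, rfl⟩, fun _ => Subsingleton.elim _ _⟩, Function.surjective_id⟩,
      .of_subsingleton M, fun n y => (ext_subsingleton_of_subsingleton_left n).elim _ _, 0, 0, hM⟩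
  | succ d =>
    obtain ⟨N, X, f, g, hs, hX, -, h0, hN⟩ := h
    exact ⟨N, X, f, g, hs, hX, h0, d, _, hN⟩

theorem Good.hasLinearResolution (h : Good Θ R d j M) :
    HasLinearResolution (extAlgGrading k (total Θ)) (extModGrading M (total Θ)) :=
  hasLinearResolution_of_filtrations (R := fun M => ∃ d j, Good Θ R d j M)
    (fun _ ⟨_, _, hM⟩ => hM.exists_ses) ⟨d, j, h⟩

theorem Good.extGenerated (h : Good Θ R d j M) : ExtGenerated M (total Θ) := by
  obtain ⟨N, X, f, g, hs, hX, h0, -⟩ := h.exists_ses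
  exact hX.extGenerated.of_pull fun n y => hs.exists_pull_of_pull_eq_zero (h0 n y)

theorem Good.isKoszulModule (h : Good Θ R d j M) :
    IsKoszulModule (extAlgGrading k (total Θ)) (extModGrading M (total Θ)) where
  graded := by
    rw [extModGrading_eq]
    exact isGradedModule_shiftGrading _ _ _
  generated := by
    rw [extModGrading_eq]
    exact h.extGenerated.generatedInDegree 0
  linear := h.hasLinearResolution

end Good

end ExtKoszul

end

/-! ### The main theorem. -/

open ExtKoszul in
theorem theorem5p2p11 {k : Type u} [Field k] {A : Type u} [Ring A] [Algebra k A]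
    [FiniteDimensional k A] {Λ : Type u} [PartialOrder Λ] [Finite Λ]
    (Θ Q : Λ → ModuleCat.{u} A)
    -- an Ext-projective stratifying system
    (hEPSS : IsEPSS Θ Q)
    -- the `Θ_i` have simple, pairwise non-isomorphic tops
    (hTop : ∀ i, IsSimpleModule A (TopOf A (Θ i)))
    (hTopNe : ∀ i j, i ≠ j → IsEmpty (TopOf A (Θ i) ≃ₗ[A] TopOf A (Θ j)))
    (hExt : ∀ s : ℕ, 1 ≤ s → Subsingleton (Abelian.Ext (total Q) (total Θ) s))
    (hHom : HomIsoEnd (total Q) (total Θ))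
    (hLin : ∀ i, IsLinearlyFiltered Θ Q (Θ i)) :
    (∀ M : ModuleCat.{u} A, InF Θ M → IsLinearlyFiltered Θ Q M →
      IsKoszulModule (extAlgGrading k (total Θ)) (extModGrading M (total Θ))) ∧
    IsKoszulAlgebra (extAlgGrading k (total Θ)) := by
  have hN : IsNoetherianRing A := isNoetherian_of_tower k inferInstance
  have hA : IsArtinianRing A := isArtinian_of_tower k inferInstance
  have hΘ := hEPSS.isStratified hTop hTopNe hExt
  have hcov := fun μ => hEPSS.exists_cover hΘ hExt hHom (hLin μ)
  obtain ⟨d, hd⟩ := exists_ht_lt Λ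
  -- All heights are below `d`, hence below `i + d`, so one bound serves every starting height.
  have hgood : ∀ {i : ℕ} {Ω : ℕ → ModuleCat.{u} A}, IsLinearSeq Θ Q i Ω →
      Good Θ (atHt Λ) d i (Ω 0) := fun h =>
    h.good hΘ hEPSS.filt hExt hcov d fun x => by have := hd x; omega
  refine ⟨fun M _ hM => ?_, ?_⟩
  · obtain ⟨i, Ω, ⟨e⟩, hsyz, hgen⟩ := hM
    exact ((hgood ⟨hsyz, hgen⟩).of_equiv e).isKoszulModule
  · choose K P κ π hκ Ω hΩ e using hcov
    have hC := IsCover.pi hκ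
    have hK : Good Θ (fun _ => Set.univ) d 1 (ModuleCat.of A (∀ μ, K μ)) := by
      refine Good.pi _ fun μ => ?_
      obtain ⟨e'⟩ := e μ
      exact ((hgood (hΩ μ)).of_equiv e').forget 1
    -- The first layer of `P` is the whole of `Θ`, with all heights mixed, and the next step is the
    -- sum of the kernels. As Ext^*(P,Θ) is `Γ_0`, this provides its linear resolution.
    have hP : Good Θ (fun _ => Set.univ) (d + 1) 0 (ModuleCat.of A (∀ μ, P μ)) :=
      ⟨_, total Θ, piMap κ, piMap π, hC.ses, .pi Θ (.component Θ),
        Filt.pi Θ fun μ => Filt.single (Set.mem_univ μ), hC.pull_eq_zero, hK⟩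
    have hfin := hEPSS.finite_Θ
    have hT : Module.Finite A (total Θ) := inferInstanceAs (Module.Finite A (∀ i, Θ i))
    exact ⟨⟨isInternal_extAlgGrading _, one_mem_extAlgGrading _, fun i =>
      haveI := ext_finite (k := k) i (total Θ) (total Θ)
      Module.Finite.range (algOf k (total Θ) i),
      extAlgGrading_mul_eq hC.ses hC.proj.ext hK.extGenerated⟩,
      isKoszulModule_degZero hC.ses.surj hC.proj.ext
        (fun n y => hC.ses.exists_pull_of_pull_eq_zero (hC.pull_eq_zero n y))
        hP.hasLinearResolution⟩
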